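/- **Setting.** Let $\mathbb{E},\mathbb{H}$ be finite-dimensional real vector spaces with duals $\mathbb{E}^*,\mathbb{H}^*$, and let $K\subset\mathbb{E}$ be a regular cone (closed, convex, containing no line, with nonempty interior) with dual cone $K^*=\{s\in\mathbb{E}^*:\langle s,x\rangle\ge 0\ \forall x\in K\}$. Let $F$ be a $\nu$-normal barrier for $K$: a $C^3$ convex function on $\operatorname{int}K$, tending to $+\infty$ at the boundary of $K$, with $|\nabla^3F(x)[h,h,h]|\le 2\langle\nabla^2F(x)h,h\rangle^{3/2}$ and $F(\tau x)=F(x)-\nu\ln\tau$ for $x\in\operatorname{int}K$, $h\in\mathbb{E}$, $\tau>0$. Let $F_*(s)=\max_{x\in\operatorname{int}K}\{-\langle s,x\rangle-F(x)\}$ for $s\in\operatorname{int}K^*$. Let $A:\mathbb{E}\to\mathbb{H}^*$ be linear and surjective, with adjoint $A^*:\mathbb{H}\to\mathbb{E}^*$, let $b\in\mathbb{H}^*$, $c\in\mathbb{E}^*$, and assume strict feasibility: there are $x_0\in\operatorname{int}K$, $s_0\in\operatorname{int}K^*$, $y_0\in\mathbb{H}$ with $Ax_0=b$ and $s_0+A^*y_0=c$.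 Put $$s(y)=c-A^*y,\quad Q=\{y\in\mathbb{H}:s(y)\in K^*\},\quad f(y)=F_*(s(y)),\quad f^*=\max_{y\in Q}\langle b,y\rangle .$$ For $\mu>0$ let $(x_\mu,s_\mu,y_\mu)$ be the central path point, i.e. the solution of $x_\mu\in\operatorname{int}K$, $Ax_\mu=b$, $c+\mu\nabla F(x_\mu)=A^*y_\mu$, $s_\mu=-\mu\nabla F(x_\mu)$. Let $B=\nabla^2F(x_1)$ (the Hessian at $x_\mu$ with $\mu=1$) and $\|x\|_B=\langle Bx,x\rangle^{1/2}$ for $x\in\mathbb{E}$. Let $(s_*,y_*)$ be an optimal solution of the dual problem $\max\{\langle b,y\rangle: s+A^*y=c,\ s\in K^*\}$, and let $\sigma_d$ be a constant such that $$\|\nabla^2F_*(s_\mu)s_*\|_B\le\sigma_d\qquad\text{for all }\mu\in(0,1].$$ For $\mu\in(0,1]$ let $$\mathcal N(\mu,\beta)=\Big\{y\in\operatorname{int}Q:\ \big\|\nabla f(y)-\tfrac1\mu b\big\|_y\le\beta\Big\},\qquad \|g\|_y=\langle g,[\nabla^2f(y)]^{-1}g\rangle^{1/2}\ \ (g\in\mathbb{H}^*).$$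 **Lemma.** Let $y\in\mathcal N(\mu,\beta)$ with $\mu\in(0,1]$ and $\beta\in[0,\tfrac19]$. Then $$\|\nabla^2F_*(s(y))s_*\|_B\le\sigma_d+\frac{6\nu^2}{\mu}\beta,\qquad f^*-\langle b,y\rangle\le\kappa_1\,\mu,\quad\text{where }\ \kappa_1=\nu+\frac{\beta(\beta+\sqrt\nu)}{1-\beta}.$$ -/

import Mathlib

open Set Filter Topology

noncomputable section

namespace ConicIPM

/-! ### Linear algebra: gradients, Hessians, norms, bidual -/

section Basic

variable {V : Type*} [NormedAddCommGroup V] [NormedSpace ℝ V]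

/-- The gradient `∇Φ(x) ∈ V*`. -/
def grad (Φ : V → ℝ) (x : V) : StrongDual ℝ V := fderiv ℝ Φ x

/-- The Hessian `∇²Φ(x) : V → V*`. -/
def hess (Φ : V → ℝ) (x : V) : V →L[ℝ] StrongDual ℝ V := fderiv ℝ (grad Φ) x

/-- The norm `‖x‖_T = ⟨T x, x⟩^{1/2}` on `V` given by a positive definite `T : V → V*`. -/
def primalNorm (T : V →L[ℝ] StrongDual ℝ V) (x : V) : ℝ := Real.sqrt (T x x)

/-- The dual norm `‖s‖_T = ⟨s, T⁻¹ s⟩^{1/2}` on `V*` given by a positive definite `T : V → V*`. -/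
def dualNorm (T : V →L[ℝ] StrongDual ℝ V) (s : StrongDual ℝ V) : ℝ :=
  Real.sqrt (s (T.inverse s))

variable [FiniteDimensional ℝ V]

theorem inclusionInDoubleDual_bijective :
    Function.Bijective (NormedSpace.inclusionInDoubleDual ℝ V) := by
  have hinj : Function.Injective (NormedSpace.inclusionInDoubleDual ℝ V) :=
    (NormedSpace.inclusionInDoubleDualLi (E := V) ℝ).injective
  have hd : ∀ (W : Type _) [NormedAddCommGroup W] [NormedSpace ℝ W] [FiniteDimensional ℝ W],
      Module.finrank ℝ (StrongDual ℝ W) = Module.finrank ℝ W := by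
    intro W _ _ _
    rw [← LinearEquiv.finrank_eq (LinearMap.toContinuousLinearMap (𝕜 := ℝ) (E := W) (F' := ℝ))]
    exact Subspace.dual_finrank_eq
  refine ⟨hinj, ?_⟩
  exact (LinearMap.injective_iff_surjective_of_finrank_eq_finrank
    (f := (NormedSpace.inclusionInDoubleDual ℝ V).toLinearMap)
    (by rw [hd, hd])).1 hinj

/-- The canonical identification `x ↦ (s ↦ ⟨s, x⟩)` of a finite-dimensional space with its
bidual. -/
def bidualEquiv (V : Type*) [NormedAddCommGroup V] [NormedSpace ℝ V] [FiniteDimensional ℝ V] :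
    V ≃ₗ[ℝ] StrongDual ℝ (StrongDual ℝ V) :=
  LinearEquiv.ofBijective (NormedSpace.inclusionInDoubleDual ℝ V).toLinearMap
    inclusionInDoubleDual_bijective

/-- For a function `Φ` on the dual space `V*`, its Hessian regarded as a linear map
`∇²Φ(s) : V* → V`, by means of `V** = V`. -/
def dualHess (Φ : StrongDual ℝ V → ℝ) (s : StrongDual ℝ V) : StrongDual ℝ V →ₗ[ℝ] V :=
  (bidualEquiv V).symm.toLinearMap ∘ₗ (hess Φ s).toLinearMap

end Basic

/-! ### Cones and barriers -/

section Cones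

variable {E : Type*} [NormedAddCommGroup E] [NormedSpace ℝ E]

/-- A closed convex cone is regular if it contains no line and has nonempty interior. -/
structure IsRegular (K : ProperCone ℝ E) : Prop where
  salient : ∀ x ∈ K, -x ∈ K → x = 0
  interior_nonempty : (interior (K : Set E)).Nonempty

/-- The dual cone `K* = {s ∈ E* : ⟨s, x⟩ ≥ 0 for all x ∈ K}`. -/
def dualCone (K : ProperCone ℝ E) : Set (StrongDual ℝ E) :=
  {s | ∀ x ∈ K, 0 ≤ s x}

/-- `F` is a `ν`-normal barrier for `K`: a `C³` convex function on `int K`, tending to `+∞` at the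
boundary of `K`, self-concordant, and `ν`-logarithmically homogeneous. The values of `F` outside
`int K` are irrelevant. -/
structure IsNormalBarrier (K : ProperCone ℝ E) (F : E → ℝ) (ν : ℝ) : Prop where
  contDiffOn : ContDiffOn ℝ 3 F (interior (K : Set E))
  convexOn : ConvexOn ℝ (interior (K : Set E)) F
  tendsto_boundary : ∀ x ∈ frontier (K : Set E),
    Tendsto F (𝓝[interior (K : Set E)] x) atTop
  selfConcordant : ∀ x ∈ interior (K : Set E), ∀ h : E,
    |iteratedFDeriv ℝ 3 F x (fun _ => h)| ≤ 2 * (hess F x h h) ^ (3 / 2 : ℝ)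
  logHomogeneous : ∀ x ∈ interior (K : Set E), ∀ τ : ℝ, 0 < τ →
    F (τ • x) = F x - ν * Real.log τ

/-- The dual barrier `F_*(s) = max_{x ∈ int K} (-⟨s, x⟩ - F(x))`, used for `s ∈ int K*`. -/
def dualBarrier (K : ProperCone ℝ E) (F : E → ℝ) (s : StrongDual ℝ E) : ℝ :=
  sSup ((fun x => -s x - F x) '' interior (K : Set E))

end Cones

/-! ### The conic problem, its central path and its dual -/

section Problem

variable {E : Type*} [NormedAddCommGroup E] [NormedSpace ℝ E]
variable {H : Type*} [NormedAddCommGroup H] [NormedSpace ℝ H]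
variable (K : ProperCone ℝ E) (F : E → ℝ) (A : E →L[ℝ] StrongDual ℝ H)
  (b : StrongDual ℝ H) (c : StrongDual ℝ E)

/-- Strict feasibility of the primal problem `min {⟨c, x⟩ : A x = b, x ∈ K}` and of its dual
`max {⟨b, y⟩ : s + A* y = c, s ∈ K*}`. Here `A* = A.flip`. -/
def StrictlyFeasible : Prop :=
  ∃ x₀ ∈ interior (K : Set E), ∃ s₀ ∈ interior (dualCone K), ∃ y₀ : H,
    A x₀ = b ∧ s₀ + A.flip y₀ = c

/-- The dual slack `s(y) = c - A* y`. -/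
def slack (y : H) : StrongDual ℝ E := c - A.flip y

/-- The feasible set `Q = {y : c - A* y ∈ K*}`. -/
def feasibleSet : Set H := {y | slack A c y ∈ dualCone K}

/-- The optimal value `f^* = max {⟨b, y⟩ : y ∈ Q}`. -/
def optimalValue : ℝ := sSup (b '' feasibleSet K A c)

/-- `(s, y)` is an optimal solution of the dual problem. -/
def IsDualOptimal (s : StrongDual ℝ E) (y : H) : Prop :=
  s ∈ dualCone K ∧ s + A.flip y = c ∧ ∀ y' ∈ feasibleSet K A c, b y' ≤ b y

/-- The barrier `f(y) = F_*(c - A* y)` of `Q`. -/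
def feasibleBarrier (y : H) : ℝ := dualBarrier K F (slack A c y)

/-- The system that defines the point `(x_μ, s_μ, y_μ)` of the primal-dual central path. -/
def IsCentral (μ : ℝ) (z : E × StrongDual ℝ E × H) : Prop :=
  z.1 ∈ interior (K : Set E) ∧ A z.1 = b ∧ c + μ • grad F z.1 = A.flip z.2.2 ∧
    z.2.1 = -(μ • grad F z.1)

/-- The primal-dual central path `μ ↦ (x_μ, s_μ, y_μ)`: the solution of the system `IsCentral`
(for a strictly feasible problem and `μ > 0` it exists and, when `A` is onto, is unique). -/
def centralPath (μ : ℝ) : E × StrongDual ℝ E × H :=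
  Classical.epsilon (IsCentral K F A b c μ)

/-- `x_μ`. -/
def centralX (μ : ℝ) : E := (centralPath K F A b c μ).1

/-- `s_μ`. -/
def centralS (μ : ℝ) : StrongDual ℝ E := (centralPath K F A b c μ).2.1

/-- The operator `B = ∇²F(x_1)` that fixes the Euclidean norms on `E` and `E*`. -/
def metricB : E →L[ℝ] StrongDual ℝ E := hess F (centralX K F A b c 1)

/-- The neighbourhood `N(μ, β)` of the central path: the points `y` in the interior of `Q` at which
the norm of `∇f(y) - μ⁻¹ b`, dual to the local norm of `∇²f(y)`, is at most `β`. -/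
def neighborhood (μ β : ℝ) : Set H :=
  {y | y ∈ interior (feasibleSet K A c) ∧
    dualNorm (hess (feasibleBarrier K F A c) y)
      (grad (feasibleBarrier K F A c) y - μ⁻¹ • b) ≤ β}

end Problem

end ConicIPM

end

/-! Write `x(s)` (`legendrePoint`) for the point of `int K` with `∇F(x(s)) = -s`. Then `∇F_*(s) =
-x(s)` and `∇²F_*(s) = ∇²F(x(s))⁻¹`, so the dual barrier inherits self-concordance along segments
from `F`, without three derivatives of `F_*` itself. Homogeneity gives `x(s_μ) = x_μ/μ`. Put `s =
s(y)` and `r = ‖s_μ - s‖` in the local norm of `∇²F_*(s)`.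

Closeness (`sqrt_hess_sub_central_le`): since `A x_μ = b`, the pairing of `s_μ - s` with `x(s) -
x(s_μ)` is the residual `∇f(y) - b/μ` applied to `y - y_μ`, hence at most `βr`. Self-concordance
bounds it below by `r²/(1+r)`, so `r ≤ β/(1-β)`.

Objective gap (`optimalValue_sub_le`): `f^* - ⟨b, y_μ⟩ ≤ μν` by duality, and the residual bound with
`‖x(s)‖² = ν` in the norm of `∇²F(x(s))` gives `⟨b, y_μ - y⟩ ≤ μ(β + √ν)r`.

Hessian bound (`primalNorm_dualHess_slack_le`): by the triangle inequality it suffices to bound the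
difference `D` of the Hessians at `s` and `s_μ`, applied to `s_*`. Three factors multiply to
`6ν²β/μ`. Stability of the Hessian at distance `β/(1-β)` contributes `3β`. The local size of `s_*`
at `s_μ` is at most `⟨s_*, x_μ⟩/μ ≤ ν`. Passing from the local norm at `x_μ/μ` to the `B`-norm costs
`⟨s_1, x_μ⟩/μ ≤ 2ν/μ`, by `primalNorm_hess_le`. -/

namespace ConicIPM

/-! ### Functions of one variable -/

/-- If `|g'| ≤ 2 g^{3/2}`, then `g^{-1/2}` is `1`-Lipschitz (written without division). -/
theorem sqrt_le_sqrt_mul_of_abs_deriv_le {g g' : ℝ → ℝ} {I : Set ℝ} (hI : Convex ℝ I)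
    (hg : ∀ t ∈ I, HasDerivAt g (g' t) t) (h0 : ∀ t ∈ I, 0 ≤ g t)
    (hb : ∀ t ∈ I, |g' t| ≤ 2 * (g t * √(g t))) {a b : ℝ} (ha : a ∈ I) (hbI : b ∈ I) :
    √(g a) ≤ √(g b) * (1 + |a - b| * √(g a)) := by
  -- The shift by `ε` makes `(g + ε)^{-1/2}` differentiable even where `g` vanishes; it is removed
  -- in the limit.
  have key : ∀ ε : ℝ, 0 < ε → √(g a + ε) ≤ √(g b + ε) * (1 + |a - b| * √(g a + ε)) := by
    intro ε hε
    have hpos : ∀ t ∈ I, 0 < √(g t + ε) := fun t ht =>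
      Real.sqrt_pos.2 (by linarith [h0 t ht])
    have hk : ∀ t ∈ I, HasDerivWithinAt (fun t => (√(g t + ε))⁻¹)
        (-(g' t / (2 * √(g t + ε))) / √(g t + ε) ^ 2) I t := by
      intro t ht
      have h1 : HasDerivAt (fun t => √(g t + ε)) (g' t / (2 * √(g t + ε))) t :=
        ((hg t ht).add_const ε).sqrt (by linarith [h0 t ht])
      exact (h1.inv (hpos t ht).ne').hasDerivWithinAt
    have hbd : ∀ t ∈ I, ‖-(g' t / (2 * √(g t + ε))) / √(g t + ε) ^ 2‖ ≤ 1 := by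
      intro t ht
      have hp := hpos t ht
      rw [Real.norm_eq_abs, abs_div, abs_neg, abs_div, abs_of_pos (by positivity : 0 < 2 * √(g t + ε)),
        abs_of_pos (by positivity : 0 < √(g t + ε) ^ 2), div_div, div_le_one (by positivity)]
      have h2 : √(g t) ≤ √(g t + ε) := Real.sqrt_le_sqrt (by linarith)
      have h3 : √(g t + ε) ^ 2 = g t + ε := Real.sq_sqrt (by linarith [h0 t ht])
      have h4 : g t * √(g t) ≤ √(g t + ε) ^ 2 * √(g t + ε) :=
        mul_le_mul (by linarith) h2 (Real.sqrt_nonneg _) (by positivity)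
      linarith [hb t ht]
    have hL := hI.norm_image_sub_le_of_norm_hasDerivWithin_le hk hbd ha hbI
    rw [one_mul, Real.norm_eq_abs, Real.norm_eq_abs, abs_sub_comm b a] at hL
    have hA := hpos a ha
    have hB := hpos b hbI
    have h5 := (abs_le.1 hL).2
    have h6 : √(g a + ε) * √(g b + ε) * ((√(g b + ε))⁻¹ - (√(g a + ε))⁻¹)
        ≤ √(g a + ε) * √(g b + ε) * |a - b| := mul_le_mul_of_nonneg_left h5 (by positivity)
    have h7 : √(g a + ε) * √(g b + ε) * ((√(g b + ε))⁻¹ - (√(g a + ε))⁻¹)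
        = √(g a + ε) - √(g b + ε) := by field_simp
    linarith
  have hcont : ∀ c : ℝ, Tendsto (fun ε : ℝ => √(c + ε)) (𝓝[>] 0) (𝓝 (√c)) := by
    intro c
    have : Continuous (fun ε : ℝ => √(c + ε)) := by fun_prop
    simpa using (this.tendsto 0).mono_left nhdsWithin_le_nhds
  refine le_of_tendsto_of_tendsto (hcont (g a))
    ((hcont (g b)).mul (tendsto_const_nhds.add (tendsto_const_nhds.mul (hcont (g a))))) ?_
  filter_upwards [self_mem_nhdsWithin] with ε hε using key ε hε

/-- Lower bound for the growth of the derivative `p` of a self-concordant function. -/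
theorem growth_of_abs_deriv_le {p g g' : ℝ → ℝ} {T : ℝ} (hT : 0 ≤ T)
    (hp : ∀ t ∈ Icc 0 T, HasDerivAt p (g t) t)
    (hg : ∀ t ∈ Icc 0 T, HasDerivAt g (g' t) t) (h0 : ∀ t ∈ Icc 0 T, 0 ≤ g t)
    (hb : ∀ t ∈ Icc 0 T, |g' t| ≤ 2 * (g t * √(g t))) :
    T * g 0 / (1 + T * √(g 0)) ≤ p T - p 0 := by
  have hr := Real.sqrt_nonneg (g 0)
  have hr2 : √(g 0) ^ 2 = g 0 := Real.sq_sqrt (h0 0 ⟨le_rfl, hT⟩)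
  set r := √(g 0) with hrdef
  -- The subtracted term is the integral from `0` to `t` of `r²/(1 + τr)²`, a lower bound for `g`.
  have hq : ∀ t ∈ Icc 0 T, HasDerivAt (fun t => p t - t * g 0 / (1 + t * r))
      (g t - g 0 / (1 + t * r) ^ 2) t := by
    intro t ht
    have hpos : (0 : ℝ) < 1 + t * r := by have := mul_nonneg ht.1 hr; linarith
    have h1 : HasDerivAt (fun t : ℝ => t * g 0) (g 0) t := by
      simpa using (hasDerivAt_id t).mul_const (g 0)
    have h2 : HasDerivAt (fun t : ℝ => 1 + t * r) r t := by
      simpa using ((hasDerivAt_id t).mul_const r).const_add 1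
    have h3 := (hp t ht).sub (h1.div h2 hpos.ne')
    exact h3.congr_deriv (by field_simp; ring)
  have hm : MonotoneOn (fun t => p t - t * g 0 / (1 + t * r)) (Icc 0 T) := by
    refine monotoneOn_of_deriv_nonneg (convex_Icc 0 T)
      (fun t ht => (hq t ht).continuousAt.continuousWithinAt)
      (fun t ht => (hq t (interior_subset ht)).differentiableAt.differentiableWithinAt) ?_
    intro t ht
    have ht' := interior_subset ht
    rw [(hq t ht').deriv, sub_nonneg]
    have hpos : (0 : ℝ) < 1 + t * r := by have := mul_nonneg ht'.1 hr; linarith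
    have h4 := sqrt_le_sqrt_mul_of_abs_deriv_le (convex_Icc 0 T) hg h0 hb
      (a := 0) (b := t) ⟨le_rfl, hT⟩ ht'
    rw [zero_sub, abs_neg, abs_of_nonneg ht'.1, ← hrdef] at h4
    rw [div_le_iff₀ (by positivity), ← hr2, ← Real.sq_sqrt (h0 t ht'), ← mul_pow]
    exact pow_le_pow_left₀ hr h4 2
  have := hm ⟨le_rfl, hT⟩ ⟨hT, le_rfl⟩ hT
  simp only [zero_mul, zero_div, sub_zero] at this
  linarith

/-- Two-sided comparison of a quadratic form at the end points of a segment shorter than one in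
the local norm. -/
theorem compare_of_abs_deriv_le {g g' m m' : ℝ → ℝ}
    (hg : ∀ t ∈ Icc (0 : ℝ) 1, HasDerivAt g (g' t) t) (h0 : ∀ t ∈ Icc (0 : ℝ) 1, 0 ≤ g t)
    (hb : ∀ t ∈ Icc (0 : ℝ) 1, |g' t| ≤ 2 * (g t * √(g t)))
    (hm : ∀ t ∈ Icc (0 : ℝ) 1, HasDerivAt m (m' t) t) (hm0 : ∀ t ∈ Icc (0 : ℝ) 1, 0 ≤ m t)
    (hmb : ∀ t ∈ Icc (0 : ℝ) 1, |m' t| ≤ 2 * √(g t) * m t) (hr1 : √(g 0) < 1) :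
    (1 - √(g 0)) ^ 2 * m 0 ≤ m 1 ∧ (1 - √(g 0)) ^ 2 * m 1 ≤ m 0 := by
  have hr := Real.sqrt_nonneg (g 0)
  set r := √(g 0) with hrdef
  have hpos : ∀ t ∈ Icc (0 : ℝ) 1, 0 < 1 - t * r := by
    intro t ht
    nlinarith [ht.1, ht.2]
  have hgt : ∀ t ∈ Icc (0 : ℝ) 1, √(g t) * (1 - t * r) ≤ r := by
    intro t ht
    have h4 := sqrt_le_sqrt_mul_of_abs_deriv_le (convex_Icc 0 1) hg h0 hb
      (a := t) (b := 0) ht ⟨le_rfl, zero_le_one⟩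
    rw [sub_zero, abs_of_nonneg ht.1, ← hrdef] at h4
    linarith
  have h2 : ∀ t : ℝ, HasDerivAt (fun t : ℝ => (1 - t * r) ^ 2) (-(2 * r * (1 - t * r))) t := by
    intro t
    have h1 : HasDerivAt (fun t : ℝ => 1 - t * r) (-r) t := by
      simpa using ((hasDerivAt_id t).mul_const r).const_sub 1
    exact (h1.pow 2).congr_deriv (by push_cast; ring)
  have hL : ∀ t ∈ Icc (0 : ℝ) 1, |m' t| * (1 - t * r) ≤ 2 * r * m t := by
    intro t ht
    have h5 := mul_le_mul_of_nonneg_right (hmb t ht) (hpos t ht).le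
    have h6 := mul_le_mul_of_nonneg_right (hgt t ht) (hm0 t ht)
    linarith
  constructor
  -- With `√g ≤ r/(1-tr)`, the logarithmic derivative of `m` is at most `2r/(1-tr)` in absolute
  -- value, which is minus that of `(1-tr)²`. So the quotient increases and, below, the product
  -- decreases.
  · have hmono : MonotoneOn (fun t => m t / (1 - t * r) ^ 2) (Icc (0 : ℝ) 1) := by
      have hd : ∀ t ∈ Icc (0 : ℝ) 1, HasDerivAt (fun t => m t / (1 - t * r) ^ 2)
          ((m' t * (1 - t * r) ^ 2 - m t * -(2 * r * (1 - t * r))) / ((1 - t * r) ^ 2) ^ 2) t :=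
        fun t ht => (hm t ht).div (h2 t) (pow_pos (hpos t ht) 2).ne'
      refine monotoneOn_of_deriv_nonneg (convex_Icc 0 1)
        (fun t ht => (hd t ht).continuousAt.continuousWithinAt)
        (fun t ht => (hd t (interior_subset ht)).differentiableAt.differentiableWithinAt) ?_
      intro t ht
      have ht' := interior_subset ht
      rw [(hd t ht').deriv]
      apply div_nonneg _ (by positivity)
      have h7 : -(m' t * (1 - t * r)) ≤ |m' t| * (1 - t * r) := by
        rw [← neg_mul]
        exact mul_le_mul_of_nonneg_right (neg_le_abs _) (hpos t ht').le
      have h8 : 0 ≤ (m' t * (1 - t * r) + 2 * r * m t) * (1 - t * r) :=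
        mul_nonneg (by linarith [hL t ht']) (hpos t ht').le
      linarith
    have h9 := hmono ⟨le_rfl, zero_le_one⟩ ⟨zero_le_one, le_rfl⟩ zero_le_one
    simp only [zero_mul, sub_zero, one_pow, div_one, one_mul] at h9
    rw [le_div_iff₀ (pow_pos (by linarith) 2)] at h9
    linarith
  · have hanti : AntitoneOn (fun t => m t * (1 - t * r) ^ 2) (Icc (0 : ℝ) 1) := by
      have hd : ∀ t ∈ Icc (0 : ℝ) 1, HasDerivAt (fun t => m t * (1 - t * r) ^ 2)
          (m' t * (1 - t * r) ^ 2 + m t * -(2 * r * (1 - t * r))) t :=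
        fun t ht => (hm t ht).mul (h2 t)
      refine antitoneOn_of_deriv_nonpos (convex_Icc 0 1)
        (fun t ht => (hd t ht).continuousAt.continuousWithinAt)
        (fun t ht => (hd t (interior_subset ht)).differentiableAt.differentiableWithinAt) ?_
      intro t ht
      have ht' := interior_subset ht
      rw [(hd t ht').deriv]
      have h7 : m' t * (1 - t * r) ≤ |m' t| * (1 - t * r) :=
        mul_le_mul_of_nonneg_right (le_abs_self _) (hpos t ht').le
      have h8 : 0 ≤ (2 * r * m t - m' t * (1 - t * r)) * (1 - t * r) :=
        mul_nonneg (by linarith [hL t ht']) (hpos t ht').le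
      linarith
    have h9 := hanti ⟨le_rfl, zero_le_one⟩ ⟨zero_le_one, le_rfl⟩ zero_le_one
    simp only [zero_mul, sub_zero, one_pow, mul_one, one_mul] at h9
    linarith

/-! ### Bilinear and trilinear forms -/

section Forms

variable {V : Type*} [NormedAddCommGroup V] [NormedSpace ℝ V]

/-- A symmetric form dominated by a positive semidefinite one satisfies a Cauchy-Schwarz
inequality. -/
theorem sq_le_of_abs_le {S Q : V →L[ℝ] StrongDual ℝ V} {κ : ℝ}
    (hS : ∀ u v, S u v = S v u) (hQ : ∀ u v, Q u v = Q v u)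
    (h : ∀ u, |S u u| ≤ κ * Q u u) (u v : V) :
    S u v ^ 2 ≤ κ ^ 2 * (Q u u * Q v v) := by
  -- Polarization: `4t S(u,v)` is the difference of the values of `S` at `u + tv` and `u - tv`, so
  -- it is at most `2κ(Q(u,u) + t²Q(v,v))`. The discriminant of this quadratic in `t` gives the
  -- claim.
  have hq : ∀ t : ℝ, 0 ≤ (κ * Q v v) * (t * t) + (-2 * S u v) * t + κ * Q u u := by
    intro t
    have h1 := (abs_le.1 (h (u + t • v))).2
    have h2 := (abs_le.1 (h (u - t • v))).1
    simp only [map_add, map_sub, map_smul, add_apply,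
      sub_apply, smul_apply, smul_eq_mul] at h1 h2
    have h3 := hS u v
    have h4 := hQ u v
    rw [← h3, ← h4] at h1 h2
    nlinarith
  have := discrim_le_zero hq
  unfold discrim at this
  nlinarith

theorem cauchy_schwarz {Q : V →L[ℝ] StrongDual ℝ V} (hQ : ∀ u v, Q u v = Q v u)
    (h : ∀ u, 0 ≤ Q u u) (u v : V) : |Q u v| ≤ √(Q u u) * √(Q v v) := by
  rw [← Real.sqrt_mul (h u)]
  apply Real.abs_le_sqrt
  have := sq_le_of_abs_le hQ hQ (κ := 1) (fun u => by rw [abs_of_nonneg (h u), one_mul]) u v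
  linarith

theorem primalNorm_add_le {Q : V →L[ℝ] StrongDual ℝ V} (hQ : ∀ u v, Q u v = Q v u)
    (h : ∀ u, 0 ≤ Q u u) (u v : V) :
    primalNorm Q (u + v) ≤ primalNorm Q u + primalNorm Q v := by
  unfold primalNorm
  rw [Real.sqrt_le_left (by positivity)]
  have h1 := (abs_le.1 (cauchy_schwarz hQ h u v)).2
  have h2 := Real.sq_sqrt (h u)
  have h3 := Real.sq_sqrt (h v)
  simp only [map_add, add_apply]
  rw [hQ v u]
  nlinarith

/-- A positive definite form on a finite-dimensional space is an isomorphism onto the dual. -/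
theorem exists_equiv_of_pos [FiniteDimensional ℝ V] {Q : V →L[ℝ] StrongDual ℝ V}
    (h : ∀ u, u ≠ 0 → 0 < Q u u) :
    ∃ e : V ≃L[ℝ] StrongDual ℝ V, (e : V →L[ℝ] StrongDual ℝ V) = Q := by
  have hinj : Function.Injective Q.toLinearMap := by
    rw [injective_iff_map_eq_zero]
    intro u hu
    by_contra hne
    have h1 := h u hne
    have h2 : Q u = 0 := hu
    rw [h2] at h1
    exact lt_irrefl _ h1
  have hfin : Module.finrank ℝ V = Module.finrank ℝ (StrongDual ℝ V) := by
    rw [← LinearEquiv.finrank_eq (LinearMap.toContinuousLinearMap (𝕜 := ℝ) (E := V) (F' := ℝ))]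
    exact Subspace.dual_finrank_eq.symm
  exact ⟨(LinearMap.linearEquivOfInjective _ hinj hfin).toContinuousLinearEquiv, by ext; rfl⟩

/-- With `c = cos t`, `s = sin t`, `r = √3`, the left side is a trilinear form at `(u, v, v)` in the
plane of `v` and `q`, where `u` has angle `3t` from `v`. The right side combines the diagonal values
at the angles `t`, `t + 60°`, `t + 120°`, with weights whose absolute values sum to one. -/
theorem trisection_identity {c s r x₀ x₁ x₂ x₃ : ℝ} (h1 : s ^ 2 + c ^ 2 = 1) (h3 : r ^ 2 = 3) :
    (4 * c ^ 3 - 3 * c) * x₀ + (3 * s - 4 * s ^ 3) * x₁ =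
      (4 * c ^ 2 - 1) ^ 2 / 9 *
        (c * (c * (c * x₀ + s * x₁) + s * (c * x₁ + s * x₂)) +
          s * (c * (c * x₁ + s * x₂) + s * (c * x₂ + s * x₃))) -
      4 / 9 * (s ^ 2 * (s - r * c) ^ 2) *
        ((c / 2 - r / 2 * s) *
          ((c / 2 - r / 2 * s) * ((c / 2 - r / 2 * s) * x₀ + (s / 2 + r / 2 * c) * x₁) +
            (s / 2 + r / 2 * c) * ((c / 2 - r / 2 * s) * x₁ + (s / 2 + r / 2 * c) * x₂)) +
        (s / 2 + r / 2 * c) *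
          ((c / 2 - r / 2 * s) * ((c / 2 - r / 2 * s) * x₁ + (s / 2 + r / 2 * c) * x₂) +
            (s / 2 + r / 2 * c) * ((c / 2 - r / 2 * s) * x₂ + (s / 2 + r / 2 * c) * x₃))) +
      4 / 9 * (s ^ 2 * (s + r * c) ^ 2) *
        ((-c / 2 - r / 2 * s) *
          ((-c / 2 - r / 2 * s) * ((-c / 2 - r / 2 * s) * x₀ + (-s / 2 + r / 2 * c) * x₁) +
            (-s / 2 + r / 2 * c) * ((-c / 2 - r / 2 * s) * x₁ + (-s / 2 + r / 2 * c) * x₂)) +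
        (-s / 2 + r / 2 * c) *
          ((-c / 2 - r / 2 * s) * ((-c / 2 - r / 2 * s) * x₁ + (-s / 2 + r / 2 * c) * x₂) +
            (-s / 2 + r / 2 * c) * ((-c / 2 - r / 2 * s) * x₂ + (-s / 2 + r / 2 * c) * x₃))) := by
  grind

/-- A bound on the diagonal of a symmetric trilinear form, for unit vectors. -/
theorem abs_trilinear_le_one {T : V →L[ℝ] V →L[ℝ] StrongDual ℝ V} {Q : V →L[ℝ] StrongDual ℝ V}
    (hT₁ : ∀ u v w, T u v w = T v u w) (hT₂ : ∀ u v w, T u v w = T u w v)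
    (hQ : ∀ u v, Q u v = Q v u) (hpos : ∀ u, u ≠ 0 → 0 < Q u u)
    (h : ∀ u, Q u u ≤ 1 → |T u u u| ≤ 1) {u v : V} (hu : Q u u = 1) (hv : Q v v = 1) :
    |T u v v| ≤ 1 := by
  have hnn : ∀ u, 0 ≤ Q u u := by
    intro u
    by_cases hu : u = 0
    · simp [hu]
    · exact (hpos u hu).le
  have hcs := cauchy_schwarz hQ hnn u v
  rw [hu, hv, Real.sqrt_one, one_mul] at hcs
  have hcos : Real.cos (Real.arccos (Q u v)) = Q u v :=
    Real.cos_arccos (abs_le.1 hcs).1 (abs_le.1 hcs).2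
  -- The angle between `u` and `v` is trisected, as `trisection_identity` requires.
  obtain ⟨t, ht⟩ : ∃ t : ℝ, Real.arccos (Q u v) = 3 * t := ⟨Real.arccos (Q u v) / 3, by ring⟩
  rw [ht] at hcos
  have hsc := Real.sin_sq_add_cos_sq (3 * t)
  obtain ⟨q, hq1, hq2, hq3⟩ : ∃ q : V, u = Real.cos (3 * t) • v + Real.sin (3 * t) • q ∧
      Q v q = 0 ∧ Q q q ≤ 1 := by
    have hvu : Q v u = Real.cos (3 * t) := by rw [hcos, hQ]
    have huv : Q u v = Real.cos (3 * t) := hcos.symm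
    by_cases hs : Real.sin (3 * t) = 0
    -- Here `u = ±v`, and `q = 0` serves; this case is why only `Q q q ≤ 1` is asked, since a
    -- one-dimensional space has no unit vector orthogonal to `v`.
    · refine ⟨0, ?_, by simp, by simp⟩
      by_contra hne
      rw [smul_zero, add_zero, ← sub_eq_zero, ← ne_eq] at hne
      have h1 := hpos _ hne
      simp only [map_sub, map_smul, sub_apply,
        smul_apply, smul_eq_mul, hu, hv, hvu, huv] at h1
      rw [hs] at hsc
      nlinarith
    · refine ⟨(Real.sin (3 * t))⁻¹ • (u - Real.cos (3 * t) • v), ?_, ?_, ?_⟩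
      · rw [smul_smul, mul_inv_cancel₀ hs, one_smul]; abel
      · simp only [map_sub, map_smul, smul_eq_mul, hv, hvu]
        ring
      · apply le_of_eq
        simp only [map_sub, map_smul, sub_apply,
          smul_apply, smul_eq_mul, hu, hv, hvu, huv]
        field_simp
        linarith
  have hct := Real.cos_three_mul t
  have hst := Real.sin_three_mul t
  have h1 := Real.sin_sq_add_cos_sq t
  set c := Real.cos t
  set s := Real.sin t
  have h3 : √3 ^ 2 = (3 : ℝ) := Real.sq_sqrt (by norm_num)
  have hunit : ∀ x y : ℝ, x ^ 2 + y ^ 2 = 1 → |T (x • v + y • q) (x • v + y • q) (x • v + y • q)| ≤ 1 := by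
    intro x y hxy
    apply h
    simp only [map_add, map_smul, add_apply,
      smul_apply, smul_eq_mul, hv, hQ q v, hq2]
    nlinarith [sq_nonneg y]
  have e0 := hunit c s (by linarith)
  have e1 := hunit (c / 2 - √3 / 2 * s) (s / 2 + √3 / 2 * c) (by
    linear_combination h1 + (s ^ 2 + c ^ 2) / 4 * h3)
  have e2 := hunit (-c / 2 - √3 / 2 * s) (-s / 2 + √3 / 2 * c) (by
    linear_combination h1 + (s ^ 2 + c ^ 2) / 4 * h3)
  have a1 := hT₁ q v v
  have a2 := hT₂ v q v
  have a3 := hT₁ q v q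
  have a4 := hT₂ q q v
  simp only [map_add, map_smul, add_apply,
    smul_apply, smul_eq_mul, hq1, hct, hst, a4, a3, a1, a2] at e0 e1 e2 ⊢
  generalize T v v v = x₀ at *
  generalize T v v q = x₁ at *
  generalize T v q q = x₂ at *
  generalize T q q q = x₃ at *
  generalize √3 = r at *
  clear_value c s
  have hid := trisection_identity (c := c) (s := s) (r := r) (x₀ := x₀) (x₁ := x₁) (x₂ := x₂)
    (x₃ := x₃) h1 h3
  rw [hid]
  have hw : (4 * c ^ 2 - 1) ^ 2 / 9 + 4 / 9 * (s ^ 2 * (s - r * c) ^ 2)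
      + 4 / 9 * (s ^ 2 * (s + r * c) ^ 2) = 1 := by
    grind
  refine (abs_add_le _ _).trans ((add_le_add_left (abs_sub _ _) _).trans ?_)
  have hwf : ∀ w f : ℝ, 0 ≤ w → |f| ≤ 1 → |w * f| ≤ w := by
    intro w f hw hf
    rw [abs_mul, abs_of_nonneg hw]
    exact mul_le_of_le_one_right hw hf
  refine le_trans ?_ hw.le
  refine add_le_add (add_le_add (hwf _ _ ?_ e0) (hwf _ _ ?_ e1)) (hwf _ _ ?_ e2) <;> positivity

/-- For a symmetric trilinear form, a bound on the diagonal extends to two coinciding arguments. -/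
theorem abs_trilinear_le {T : V →L[ℝ] V →L[ℝ] StrongDual ℝ V} {Q : V →L[ℝ] StrongDual ℝ V}
    (hT₁ : ∀ u v w, T u v w = T v u w) (hT₂ : ∀ u v w, T u v w = T u w v)
    (hQ : ∀ u v, Q u v = Q v u) (hpos : ∀ u, u ≠ 0 → 0 < Q u u)
    (h : ∀ u, |T u u u| ≤ 2 * (Q u u) ^ (3 / 2 : ℝ)) (u v : V) :
    |T u v v| ≤ 2 * √(Q u u) * Q v v := by
  by_cases hu : u = 0
  · simp [hu]
  by_cases hv : v = 0
  · simp [hv]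
  have hnn : ∀ u, 0 ≤ Q u u := by
    intro u
    by_cases hu : u = 0
    · simp [hu]
    · exact (hpos u hu).le
  have hu' := Real.sqrt_pos.2 (hpos u hu)
  have hv' := Real.sqrt_pos.2 (hpos v hv)
  have hsu := Real.sq_sqrt (hnn u)
  have hsv := Real.sq_sqrt (hnn v)
  have key := abs_trilinear_le_one (T := (2 : ℝ)⁻¹ • T) (Q := Q)
    (u := (√(Q u u))⁻¹ • u) (v := (√(Q v v))⁻¹ • v)
    (fun u v w => by simp only [smul_apply, hT₁ u v w])
    (fun u v w => by simp only [smul_apply, hT₂ u v w]) hQ hpos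
    (fun w hw => by
      have h1 : Q w w ^ (3 / 2 : ℝ) ≤ 1 := Real.rpow_le_one (hnn w) hw (by norm_num)
      have h2 := h w
      simp only [smul_apply, smul_eq_mul, abs_mul]
      rw [abs_of_pos (by norm_num : (0 : ℝ) < 2⁻¹)]
      linarith)
    (by
      simp only [map_smul, smul_apply, smul_eq_mul]
      field_simp
      exact hsu.symm)
    (by
      simp only [map_smul, smul_apply, smul_eq_mul]
      field_simp
      exact hsv.symm)
  simp only [map_smul, smul_apply, smul_eq_mul, abs_mul, abs_inv, abs_of_pos hu', abs_of_pos hv',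
    abs_two] at key
  field_simp at key
  rw [hsv] at key
  linarith

end Forms

/-- A self-concordant function that is nonincreasing along a ray is steep at the origin of the
ray. -/
theorem sqrt_le_neg_of_abs_deriv_le {p g g' : ℝ → ℝ}
    (hp : ∀ t, 0 ≤ t → HasDerivAt p (g t) t) (hg : ∀ t, 0 ≤ t → HasDerivAt g (g' t) t)
    (h0 : ∀ t, 0 ≤ t → 0 ≤ g t) (hb : ∀ t, 0 ≤ t → |g' t| ≤ 2 * (g t * √(g t)))
    (hp0 : ∀ t, 0 ≤ t → p t ≤ 0) : √(g 0) ≤ -p 0 := by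
  have hr := Real.sqrt_nonneg (g 0)
  have hr2 : √(g 0) ^ 2 = g 0 := Real.sq_sqrt (h0 0 le_rfl)
  have hgr : ∀ T : ℝ, 0 ≤ T → T * √(g 0) ^ 2 ≤ -p 0 * (1 + T * √(g 0)) := by
    intro T hT
    have h1 := growth_of_abs_deriv_le hT (fun t ht => hp t ht.1) (fun t ht => hg t ht.1)
      (fun t ht => h0 t ht.1) (fun t ht => hb t ht.1)
    rw [hr2]
    have hpos : 0 < 1 + T * √(g 0) := by positivity
    rw [div_le_iff₀ hpos] at h1
    exact h1.trans (mul_le_mul_of_nonneg_right (by linarith [hp0 T hT]) hpos.le)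
  have hp00 := hp0 0 le_rfl
  by_contra! hlt
  have hrpos : 0 < √(g 0) := by linarith
  have hd : 0 < √(g 0) * (√(g 0) + p 0) := mul_pos hrpos (by linarith)
  -- This time makes the bound `T·r·(r + p 0) ≤ -p 0`, with `r = √(g 0)`, read `-p 0 + 1 ≤ -p 0`.
  have h1 := hgr ((-p 0 + 1) / (√(g 0) * (√(g 0) + p 0)))
    (div_nonneg (by linarith) hd.le)
  have h2 : (-p 0 + 1) / (√(g 0) * (√(g 0) + p 0)) * (√(g 0) * (√(g 0) + p 0)) = -p 0 + 1 :=
    div_mul_cancel₀ _ hd.ne'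
  nlinarith

theorem rpow_three_halves {a : ℝ} (ha : 0 ≤ a) : a ^ (3 / 2 : ℝ) = a * √a := by
  rw [show (3 / 2 : ℝ) = 1 + 1 / 2 by norm_num, Real.rpow_add' ha (by norm_num), Real.rpow_one,
    Real.sqrt_eq_rpow]

/-! ### Interior and recession directions of the cone -/

section Cone

variable {E : Type*} [NormedAddCommGroup E] [NormedSpace ℝ E] {K : ProperCone ℝ E}

open scoped Pointwise in
theorem add_mem_interior {x h : E} (hx : x ∈ interior (K : Set E)) (hh : h ∈ K) :
    x + h ∈ interior (K : Set E) := by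
  have h1 : interior (K : Set E) + {h} ⊆ (K : Set E) := by
    rintro _ ⟨a, ha, b, rfl, rfl⟩
    exact K.add_mem (interior_subset ha) hh
  exact interior_maximal h1 isOpen_interior.add_right ⟨x, hx, h, rfl, rfl⟩

open scoped Pointwise in
theorem smul_mem_interior {x : E} (hx : x ∈ interior (K : Set E)) {τ : ℝ} (hτ : 0 < τ) :
    τ • x ∈ interior (K : Set E) := by
  have h1 : τ • interior (K : Set E) ⊆ (K : Set E) := by
    rintro _ ⟨a, ha, rfl⟩
    exact K.smul_mem (interior_subset ha) hτ.le
  exact interior_maximal h1 (isOpen_interior.smul₀ hτ.ne') ⟨x, hx, rfl⟩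

theorem mem_of_forall_add_smul_mem {x h : E} (hx : ∀ t : ℝ, 0 < t → x + t • h ∈ K) : h ∈ K := by
  have h1 : Tendsto (fun t : ℝ => t⁻¹ • x + h) atTop (𝓝 ((0 : ℝ) • x + h)) :=
    (tendsto_inv_atTop_zero.smul_const x).add_const h
  rw [zero_smul, zero_add] at h1
  refine K.isClosed.mem_of_tendsto h1 ?_
  filter_upwards [eventually_gt_atTop 0] with t ht
  have h2 := K.smul_mem (hx t ht) (inv_nonneg.2 ht.le)
  rwa [smul_add, smul_smul, inv_mul_cancel₀ ht.ne', one_smul] at h2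

theorem hasDerivAt_line (x h : E) (t : ℝ) : HasDerivAt (fun t : ℝ => x + t • h) h t := by
  simpa using ((hasDerivAt_id t).smul_const h).const_add x

end Cone

/-! ### Derivatives of the barrier, Dikin ellipsoid and local norms -/

namespace IsNormalBarrier

variable {E : Type*} [NormedAddCommGroup E] [NormedSpace ℝ E]
  {K : ProperCone ℝ E} {F : E → ℝ} {ν : ℝ}

theorem contDiffAt (hF : IsNormalBarrier K F ν) {x : E} (hx : x ∈ interior (K : Set E)) :
    ContDiffAt ℝ 3 F x :=
  hF.contDiffOn.contDiffAt (isOpen_interior.mem_nhds hx)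

theorem contDiffAt_grad (hF : IsNormalBarrier K F ν) {x : E} (hx : x ∈ interior (K : Set E)) :
    ContDiffAt ℝ 2 (grad F) x :=
  (hF.contDiffAt hx).fderiv_right (by norm_num)

theorem contDiffAt_hess (hF : IsNormalBarrier K F ν) {x : E} (hx : x ∈ interior (K : Set E)) :
    ContDiffAt ℝ 1 (hess F) x :=
  (hF.contDiffAt_grad hx).fderiv_right (by norm_num)

theorem hasFDerivAt (hF : IsNormalBarrier K F ν) {x : E} (hx : x ∈ interior (K : Set E)) :
    HasFDerivAt F (grad F x) x :=
  ((hF.contDiffAt hx).differentiableAt (by norm_num)).hasFDerivAt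

theorem hasStrictFDerivAt_grad (hF : IsNormalBarrier K F ν) {x : E}
    (hx : x ∈ interior (K : Set E)) : HasStrictFDerivAt (grad F) (hess F x) x :=
  (hF.contDiffAt_grad hx).hasStrictFDerivAt (by norm_num)

theorem hasFDerivAt_hess (hF : IsNormalBarrier K F ν) {x : E} (hx : x ∈ interior (K : Set E)) :
    HasFDerivAt (hess F) (fderiv ℝ (hess F) x) x :=
  ((hF.contDiffAt_hess hx).differentiableAt (by norm_num)).hasFDerivAt

theorem hess_symm (hF : IsNormalBarrier K F ν) {x : E} (hx : x ∈ interior (K : Set E)) (u v : E) :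
    hess F x u v = hess F x v u :=
  (hF.contDiffAt hx).isSymmSndFDerivAt (by simp; norm_num) u v

theorem third_symm_left (hF : IsNormalBarrier K F ν) {x : E} (hx : x ∈ interior (K : Set E))
    (u v w : E) : fderiv ℝ (hess F) x u v w = fderiv ℝ (hess F) x v u w := by
  have h := (hF.contDiffAt_grad hx).isSymmSndFDerivAt (by simp) u v
  exact congrArg (fun φ : StrongDual ℝ E => φ w) h

theorem third_symm_right (hF : IsNormalBarrier K F ν) {x : E} (hx : x ∈ interior (K : Set E))
    (u v w : E) : fderiv ℝ (hess F) x u v w = fderiv ℝ (hess F) x u w v := by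
  have h1 : ∀ v w : E, HasFDerivAt (fun z => hess F z v w)
      ((ContinuousLinearMap.apply ℝ ℝ w).comp
        ((ContinuousLinearMap.apply ℝ (StrongDual ℝ E) v).comp (fderiv ℝ (hess F) x))) x :=
    fun v w => by
      have h0 : HasFDerivAt (fun z => hess F z v)
          ((ContinuousLinearMap.apply ℝ (StrongDual ℝ E) v).comp (fderiv ℝ (hess F) x)) x :=
        HasFDerivAt.comp (f := hess F) x
          (ContinuousLinearMap.apply ℝ (StrongDual ℝ E) v).hasFDerivAt (hF.hasFDerivAt_hess hx)
      exact (ContinuousLinearMap.apply ℝ ℝ w).hasFDerivAt.comp x h0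
  have h2 : (fun z => hess F z v w) =ᶠ[𝓝 x] fun z => hess F z w v := by
    filter_upwards [isOpen_interior.mem_nhds hx] with z hz using hF.hess_symm hz v w
  have h3 := ((h1 w v).congr_of_eventuallyEq h2).unique (h1 v w)
  exact (congrArg (fun φ : E →L[ℝ] ℝ => φ u) h3).symm

theorem add_grad_le (hF : IsNormalBarrier K F ν) {x z : E} (hx : x ∈ interior (K : Set E))
    (hz : z ∈ interior (K : Set E)) : F x + grad F x (z - x) ≤ F z := by
  have hc := hF.convexOn.comp_affineMap (AffineMap.lineMap (k := ℝ) x z)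
  have hd : HasDerivAt (F ∘ (AffineMap.lineMap x z : ℝ →ᵃ[ℝ] E)) (grad F x (z - x)) 0 := by
    have h1 : HasDerivAt (AffineMap.lineMap x z : ℝ →ᵃ[ℝ] E) (z - x) (0 : ℝ) :=
      AffineMap.hasDerivAt_lineMap
    have h2 : HasFDerivAt F (grad F x) ((AffineMap.lineMap x z : ℝ →ᵃ[ℝ] E) 0) := by
      rw [AffineMap.lineMap_apply_zero]; exact hF.hasFDerivAt hx
    exact h2.comp_hasDerivAt 0 h1
  have := hc.le_slope_of_hasDerivAt (x := 0) (y := 1) (by simpa using hx) (by simpa using hz)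
    zero_lt_one hd
  simp [slope] at this
  simp only [map_sub]
  linarith

theorem grad_monotone (hF : IsNormalBarrier K F ν) {x z : E} (hx : x ∈ interior (K : Set E))
    (hz : z ∈ interior (K : Set E)) : grad F x (z - x) ≤ grad F z (z - x) := by
  have h1 := hF.add_grad_le hx hz
  have h2 := hF.add_grad_le hz hx
  rw [← neg_sub z x, map_neg] at h2
  linarith

theorem hasDerivAt_line (hF : IsNormalBarrier K F ν) {x h : E} {t : ℝ}
    (hx : x + t • h ∈ interior (K : Set E)) :
    HasDerivAt (fun t : ℝ => F (x + t • h)) (grad F (x + t • h) h) t :=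
  (hF.hasFDerivAt hx).comp_hasDerivAt t (ConicIPM.hasDerivAt_line x h t)

theorem hasDerivAt_grad_line (hF : IsNormalBarrier K F ν) {x h : E} {t : ℝ}
    (hx : x + t • h ∈ interior (K : Set E)) (k : E) :
    HasDerivAt (fun t : ℝ => grad F (x + t • h) k) (hess F (x + t • h) h k) t :=
  (ContinuousLinearMap.apply ℝ ℝ k).hasFDerivAt.comp_hasDerivAt t
    ((hF.hasStrictFDerivAt_grad hx).hasFDerivAt.comp_hasDerivAt t
      (ConicIPM.hasDerivAt_line x h t))

theorem hasDerivAt_hess_line (hF : IsNormalBarrier K F ν) {x h : E} {t : ℝ}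
    (hx : x + t • h ∈ interior (K : Set E)) (k l : E) :
    HasDerivAt (fun t : ℝ => hess F (x + t • h) k l) (fderiv ℝ (hess F) (x + t • h) h k l) t := by
  have h1 : HasDerivAt (fun t : ℝ => hess F (x + t • h)) (fderiv ℝ (hess F) (x + t • h) h) t :=
    HasFDerivAt.comp_hasDerivAt (l := hess F) t (hF.hasFDerivAt_hess hx)
      (ConicIPM.hasDerivAt_line x h t)
  have h2 : HasDerivAt (fun t : ℝ => hess F (x + t • h) k)
      (fderiv ℝ (hess F) (x + t • h) h k) t :=
    HasFDerivAt.comp_hasDerivAt (f := fun t : ℝ => hess F (x + t • h)) t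
      (ContinuousLinearMap.apply ℝ (StrongDual ℝ E) k).hasFDerivAt h1
  exact (ContinuousLinearMap.apply ℝ ℝ l).hasFDerivAt.comp_hasDerivAt t h2

theorem hess_nonneg (hF : IsNormalBarrier K F ν) {x : E} (hx : x ∈ interior (K : Set E)) (h : E) :
    0 ≤ hess F x h h := by
  have h1 := hF.hasDerivAt_grad_line (x := x) (h := h) (t := 0) (by simpa using hx) h
  rw [zero_smul, add_zero, hasDerivAt_iff_tendsto_slope] at h1
  refine ge_of_tendsto (h1.mono_left (nhdsWithin_mono 0 fun t (ht : t ∈ Ioi 0) => (ne_of_gt ht))) ?_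
  have h2 : ∀ᶠ t : ℝ in 𝓝 0, x + t • h ∈ interior (K : Set E) := by
    have : Tendsto (fun t : ℝ => x + t • h) (𝓝 0) (𝓝 (x + (0 : ℝ) • h)) :=
      (ConicIPM.hasDerivAt_line x h 0).continuousAt
    rw [zero_smul, add_zero] at this
    exact this.eventually (isOpen_interior.mem_nhds hx)
  filter_upwards [self_mem_nhdsWithin, nhdsWithin_le_nhds h2] with t ht hxt
  have h3 := hF.grad_monotone hx hxt
  rw [add_sub_cancel_left, map_smul, map_smul, smul_eq_mul, smul_eq_mul] at h3
  simp only [slope, vsub_eq_sub, smul_eq_mul, zero_smul, add_zero, sub_zero]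
  exact mul_nonneg (inv_nonneg.2 (le_of_lt ht))
    (sub_nonneg.2 (le_of_mul_le_mul_left h3 ht))

theorem abs_third_le_rpow (hF : IsNormalBarrier K F ν) {x : E} (hx : x ∈ interior (K : Set E))
    (h : E) : |fderiv ℝ (hess F) x h h h| ≤ 2 * hess F x h h ^ (3 / 2 : ℝ) := by
  have h1 := hF.selfConcordant x hx h
  rw [iteratedFDeriv_succ_apply_right, iteratedFDeriv_two_apply] at h1
  exact h1

theorem abs_third_le (hF : IsNormalBarrier K F ν) {x : E} (hx : x ∈ interior (K : Set E))
    (h : E) : |fderiv ℝ (hess F) x h h h| ≤ 2 * (hess F x h h * √(hess F x h h)) := by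
  rw [← rpow_three_halves (hF.hess_nonneg hx h)]
  exact hF.abs_third_le_rpow hx h

/-- If the second derivative stays bounded along a segment, then the segment does not leave the
interior of the cone. -/
theorem add_mem_of_hess_le (hF : IsNormalBarrier K F ν) {x h : E}
    (hx : x ∈ interior (K : Set E)) (C : ℝ)
    (hC : ∀ t ∈ Ico (0 : ℝ) 1, (∀ r ∈ Icc 0 t, x + r • h ∈ interior (K : Set E)) →
      hess F (x + t • h) h h ≤ C) : x + h ∈ interior (K : Set E) := by
  by_contra hnot
  have hcont : Continuous fun t : ℝ => x + t • h := by fun_prop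
  let S : Set ℝ := Icc 0 1 ∩ (fun t : ℝ => x + t • h) ⁻¹' (interior (K : Set E))ᶜ
  have hScomp : IsCompact S :=
    isCompact_Icc.inter_right (isOpen_interior.isClosed_compl.preimage hcont)
  have hSne : S.Nonempty := ⟨1, ⟨zero_le_one, le_rfl⟩, by simpa using hnot⟩
  have hT := hScomp.sInf_mem hSne
  -- `T` is the first exit time. There `F` tends to `+∞`, while a bounded second derivative keeps
  -- `F` bounded on the segment before `T`.
  set T := sInf S with hTdef
  have hlt : ∀ t, 0 ≤ t → t < T → x + t • h ∈ interior (K : Set E) := by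
    intro t ht htT
    by_contra hn
    exact absurd (csInf_le hScomp.bddBelow ⟨⟨ht, htT.le.trans hT.1.2⟩, hn⟩) (not_le.2 htT)
  have hTpos : 0 < T := by
    refine lt_of_le_of_ne hT.1.1 fun h0 => hT.2 ?_
    simpa [← h0] using hx
  have hev : ∀ᶠ t in 𝓝[<] T, t ∈ Ioo 0 T := Ioo_mem_nhdsLT hTpos
  have hlim : Tendsto (fun t : ℝ => x + t • h) (𝓝[<] T)
      (𝓝[interior (K : Set E)] (x + T • h)) :=
    tendsto_nhdsWithin_iff.2 ⟨(hcont.tendsto T).mono_left nhdsWithin_le_nhds,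
      hev.mono fun t ht => hlt t ht.1.le ht.2⟩
  have hfr : x + T • h ∈ frontier (K : Set E) := by
    refine ⟨closure_mono interior_subset (mem_closure_of_tendsto
      (hlim.mono_right nhdsWithin_le_nhds) (hev.mono fun t ht => hlt t ht.1.le ht.2)), hT.2⟩
  have hbig := ((hF.tendsto_boundary _ hfr).comp hlim).eventually_gt_atTop
    (F x + (|grad F x h| + |C|))
  obtain ⟨t, htF, ht⟩ := (hbig.and hev).exists
  have hin : ∀ r ∈ Icc 0 t, x + r • h ∈ interior (K : Set E) :=
    fun r hr => hlt r hr.1 (hr.2.trans_lt ht.2)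
  have ht1 : t < 1 := ht.2.trans_le hT.1.2
  have hp : ∀ r ∈ Icc 0 t, HasDerivAt (fun t : ℝ => grad F (x + t • h) h)
      (hess F (x + r • h) h h) r := fun r hr => hF.hasDerivAt_grad_line (hin r hr) h
  have hmvt := (convex_Icc 0 t).image_sub_le_mul_sub_of_deriv_le
    (fun r hr => (hp r hr).continuousAt.continuousWithinAt)
    (fun r hr => (hp r (interior_subset hr)).differentiableAt.differentiableWithinAt)
    (C := C) (fun r hr => by
      have hr' := interior_subset hr
      rw [(hp r hr').deriv]
      exact hC r ⟨hr'.1, hr'.2.trans_lt ht1⟩ fun q hq => hin q ⟨hq.1, hq.2.trans hr'.2⟩)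
    0 ⟨le_rfl, ht.1.le⟩ t ⟨ht.1.le, le_rfl⟩ ht.1.le
  simp only [zero_smul, add_zero, sub_zero] at hmvt
  have hconv := hF.add_grad_le (hin t ⟨ht.1.le, le_rfl⟩) hx
  rw [sub_add_cancel_left, map_neg, map_smul, smul_eq_mul] at hconv
  simp only [Function.comp_apply] at htF
  have h5 : C * t ≤ |C| := by
    calc C * t ≤ |C| * t := mul_le_mul_of_nonneg_right (le_abs_self C) ht.1.le
      _ ≤ |C| * 1 := mul_le_mul_of_nonneg_left ht1.le (abs_nonneg C)
      _ = |C| := mul_one _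
  have h6 : grad F (x + t • h) h ≤ |grad F x h| + |C| := by linarith [le_abs_self (grad F x h)]
  have h7 : t * grad F (x + t • h) h ≤ |grad F x h| + |C| := by
    calc t * grad F (x + t • h) h ≤ t * (|grad F x h| + |C|) :=
          mul_le_mul_of_nonneg_left h6 ht.1.le
      _ ≤ 1 * (|grad F x h| + |C|) := mul_le_mul_of_nonneg_right ht1.le (by positivity)
      _ = _ := one_mul _
  linarith

theorem sqrt_hess_line_le (hF : IsNormalBarrier K F ν) {x h : E} {t : ℝ} (ht : 0 ≤ t)
    (hin : ∀ r ∈ Icc 0 t, x + r • h ∈ interior (K : Set E)) :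
    √(hess F (x + t • h) h h) ≤ √(hess F x h h) * (1 + t * √(hess F (x + t • h) h h)) := by
  have := sqrt_le_sqrt_mul_of_abs_deriv_le (convex_Icc 0 t)
    (fun r hr => hF.hasDerivAt_hess_line (hin r hr) h h)
    (fun r hr => hF.hess_nonneg (hin r hr) h) (fun r hr => hF.abs_third_le (hin r hr) h)
    (a := t) (b := 0) ⟨ht, le_rfl⟩ ⟨le_rfl, ht⟩
  simpa [abs_of_nonneg ht] using this

/-- If the Hessian vanished on `h`, self-concordance would keep it zero along `x + ℝh`. The whole
line would then stay in the interior, and the cone contains no line. -/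
theorem hess_pos (hF : IsNormalBarrier K F ν) (hK : IsRegular K) {x : E}
    (hx : x ∈ interior (K : Set E)) {h : E} (hh : h ≠ 0) : 0 < hess F x h h := by
  by_contra! hle
  have h0 : hess F x h h = 0 := le_antisymm hle (hF.hess_nonneg hx h)
  have hline : ∀ t : ℝ, x + t • h ∈ interior (K : Set E) := by
    intro t
    refine hF.add_mem_of_hess_le hx 0 fun r hr hin => ?_
    have h1 := hF.sqrt_hess_line_le hr.1 hin
    have h2 : hess F x (t • h) (t • h) = 0 := by simp [h0]
    rw [h2, Real.sqrt_zero, zero_mul, Real.sqrt_le_left le_rfl] at h1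
    simpa using h1
  refine hh (hK.salient h (mem_of_forall_add_smul_mem fun t _ => interior_subset (hline t))
    (mem_of_forall_add_smul_mem (x := x) fun t _ => ?_))
  rw [smul_neg, ← neg_smul]
  exact interior_subset (hline _)

/-- The Dikin ellipsoid is contained in the cone. -/
theorem add_mem_of_hess_lt_one (hF : IsNormalBarrier K F ν) {x : E}
    (hx : x ∈ interior (K : Set E)) {h : E} (hh : hess F x h h < 1) :
    x + h ∈ interior (K : Set E) := by
  have hr : √(hess F x h h) < 1 := by
    rw [Real.sqrt_lt' one_pos]; simpa using hh
  have hr0 := Real.sqrt_nonneg (hess F x h h)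
  refine hF.add_mem_of_hess_le hx ((√(hess F x h h) / (1 - √(hess F x h h))) ^ 2)
    fun t ht hin => ?_
  have h1 := hF.sqrt_hess_line_le ht.1 hin
  have hg := Real.sqrt_nonneg (hess F (x + t • h) h h)
  have hnn := hF.hess_nonneg (hin t ⟨ht.1, le_rfl⟩) h
  rw [← Real.sqrt_le_left (div_nonneg hr0 (by linarith)), le_div_iff₀ (by linarith)]
  have h2 : √(hess F x h h) * (t * √(hess F (x + t • h) h h)) ≤
      √(hess F x h h) * (1 * √(hess F (x + t • h) h h)) := by
    gcongr
    exact ht.2.le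
  linarith

/-! ### Consequences of logarithmic homogeneity -/

theorem grad_smul (hF : IsNormalBarrier K F ν) {x : E} (hx : x ∈ interior (K : Set E)) {τ : ℝ}
    (hτ : 0 < τ) : grad F (τ • x) = τ⁻¹ • grad F x := by
  have h1 : HasFDerivAt (fun z => F (τ • z)) ((grad F (τ • x)).comp (τ • ContinuousLinearMap.id ℝ E)) x :=
    (hF.hasFDerivAt (smul_mem_interior hx hτ)).comp x ((hasFDerivAt_id x).const_smul τ)
  have h2 : HasFDerivAt (fun z => F z - ν * Real.log τ) (grad F x) x :=
    (hF.hasFDerivAt hx).sub_const _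
  have h3 : (fun z => F (τ • z)) =ᶠ[𝓝 x] fun z => F z - ν * Real.log τ := by
    filter_upwards [isOpen_interior.mem_nhds hx] with z hz using hF.logHomogeneous z hz τ hτ
  have h4 := h1.unique (h2.congr_of_eventuallyEq h3)
  rw [← h4]
  ext v
  simp [hτ.ne']

theorem grad_self (hF : IsNormalBarrier K F ν) {x : E} (hx : x ∈ interior (K : Set E)) :
    grad F x x = -ν := by
  have h1 : HasDerivAt (fun t : ℝ => F (t • x)) (grad F x x) 1 := by
    have := hF.hasDerivAt_line (x := 0) (h := x) (t := 1) (by simpa using hx)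
    simpa using this
  have h2 : HasDerivAt (fun t : ℝ => F x - ν * Real.log t) (-(ν * (1 : ℝ)⁻¹)) 1 :=
    ((Real.hasDerivAt_log one_ne_zero).const_mul ν).const_sub _
  have h3 : (fun t : ℝ => F (t • x)) =ᶠ[𝓝 1] fun t : ℝ => F x - ν * Real.log t := by
    filter_upwards [lt_mem_nhds zero_lt_one] with t ht using hF.logHomogeneous x hx t ht
  simpa using h1.unique (h2.congr_of_eventuallyEq h3)

theorem hess_self (hF : IsNormalBarrier K F ν) {x : E} (hx : x ∈ interior (K : Set E)) :
    hess F x x x = ν := by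
  have h1 : HasDerivAt (fun t : ℝ => grad F (t • x) x) (hess F x x x) 1 := by
    have := hF.hasDerivAt_grad_line (x := 0) (h := x) (t := 1) (by simpa using hx) x
    simpa using this
  have h2 : HasDerivAt (fun t : ℝ => t⁻¹ * grad F x x) (-((1 : ℝ) ^ 2)⁻¹ * grad F x x) 1 :=
    (hasDerivAt_inv one_ne_zero).mul_const _
  have h3 : (fun t : ℝ => grad F (t • x) x) =ᶠ[𝓝 1] fun t : ℝ => t⁻¹ * grad F x x := by
    filter_upwards [lt_mem_nhds zero_lt_one] with t ht
    rw [hF.grad_smul hx ht, smul_apply, smul_eq_mul]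
  have h4 := h1.unique (h2.congr_of_eventuallyEq h3)
  rw [h4, hF.grad_self hx]
  norm_num

theorem nonneg (hF : IsNormalBarrier K F ν) (hK : IsRegular K) : 0 ≤ ν := by
  obtain ⟨x, hx⟩ := hK.interior_nonempty
  rw [← hF.hess_self hx]
  exact hF.hess_nonneg hx x

/-- The tangent inequality at `z`, tested at `τh` for an interior `h`, bounds `τ⟨∇F(z), h⟩` by a
constant minus `ν log τ`; divide by `τ → ∞`. A boundary `h` is shifted inwards by a small multiple
of `z`, at a cost controlled by `⟨∇F(z), z⟩ = -ν`. -/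
theorem grad_nonpos (hF : IsNormalBarrier K F ν) (hK : IsRegular K) {z h : E}
    (hz : z ∈ interior (K : Set E)) (hh : h ∈ K) : grad F z h ≤ 0 := by
  have hint : ∀ h ∈ interior (K : Set E), grad F z h ≤ 0 := by
    intro h hh
    have hlim : Tendsto (fun τ : ℝ => (F h - F z + grad F z z) * τ⁻¹ - ν * (Real.log τ / τ)) atTop
        (𝓝 ((F h - F z + grad F z z) * 0 - ν * 0)) :=
      (tendsto_inv_atTop_zero.const_mul _).sub
        (Real.isLittleO_log_id_atTop.tendsto_div_nhds_zero.const_mul ν)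
    rw [mul_zero, mul_zero, sub_zero] at hlim
    refine ge_of_tendsto hlim ?_
    filter_upwards [eventually_gt_atTop 0] with τ hτ
    have h1 := hF.add_grad_le hz (smul_mem_interior hh hτ)
    rw [hF.logHomogeneous h hh τ hτ, map_sub, map_smul, smul_eq_mul] at h1
    rw [← mul_div_assoc, ← div_eq_mul_inv, ← sub_div, le_div_iff₀ hτ]
    linarith
  have hν := hF.nonneg hK
  refine le_of_forall_pos_le_add fun ε hε => ?_
  have h2 := hint ((ε / (ν + 1)) • z + h)
    (add_mem_interior (smul_mem_interior hz (by positivity)) hh)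
  rw [map_add, map_smul, smul_eq_mul, hF.grad_self hz] at h2
  have h3 : ε / (ν + 1) * ν ≤ ε := by
    rw [div_mul_eq_mul_div, div_le_iff₀ (by positivity)]
    nlinarith
  linarith

/-- The ray `x + th` stays in the interior and `F` is nonincreasing along it. -/
theorem sqrt_hess_le_neg_grad (hF : IsNormalBarrier K F ν) (hK : IsRegular K) {x h : E}
    (hx : x ∈ interior (K : Set E)) (hh : h ∈ K) : √(hess F x h h) ≤ -grad F x h := by
  have hin : ∀ t : ℝ, 0 ≤ t → x + t • h ∈ interior (K : Set E) :=
    fun t ht => add_mem_interior hx (K.smul_mem hh ht)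
  have := sqrt_le_neg_of_abs_deriv_le (fun t ht => hF.hasDerivAt_grad_line (hin t ht) h)
    (fun t ht => hF.hasDerivAt_hess_line (hin t ht) h h)
    (fun t ht => hF.hess_nonneg (hin t ht) h) (fun t ht => hF.abs_third_le (hin t ht) h)
    (fun t ht => hF.grad_nonpos hK (hin t ht) hh)
  simpa using this

/-- Comparison of local norms at two points of the cone. -/
theorem primalNorm_hess_le (hF : IsNormalBarrier K F ν) (hK : IsRegular K) {x z : E}
    (hx : x ∈ interior (K : Set E)) (hz : z ∈ interior (K : Set E)) (h : E) :
    primalNorm (hess F z) h ≤ -grad F z x * primalNorm (hess F x) h := by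
  have hsmul : ∀ (x : E) (t : ℝ), 0 ≤ t → ∀ k : E,
      primalNorm (hess F x) (t • k) = t * primalNorm (hess F x) k := by
    intro x t ht k
    simp only [primalNorm, map_smul, smul_apply, smul_eq_mul]
    rw [← mul_assoc, Real.sqrt_mul (mul_nonneg ht ht), Real.sqrt_mul_self ht]
  -- Both `x + k` and `x - k` lie in the cone. Adding the bounds of their norms at `z` by minus the
  -- gradient cancels the `k` terms and leaves `2‖k‖ ≤ -2⟨∇F(z), x⟩`.
  have hball : ∀ k : E, hess F x k k < 1 → primalNorm (hess F z) k ≤ -grad F z x := by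
    intro k hk
    have hk' : hess F x (-k) (-k) < 1 := by simpa using hk
    have h1 := hF.sqrt_hess_le_neg_grad hK hz (interior_subset (hF.add_mem_of_hess_lt_one hx hk))
    have h2 := hF.sqrt_hess_le_neg_grad hK hz (interior_subset (hF.add_mem_of_hess_lt_one hx hk'))
    have h3 := primalNorm_add_le (hF.hess_symm hz) (hF.hess_nonneg hz) (x + k) (-(x + -k))
    have h4 : primalNorm (hess F z) (-(x + -k)) = primalNorm (hess F z) (x + -k) := by
      simp only [primalNorm, map_neg, neg_apply, neg_neg]
    have h5 : x + k + -(x + -k) = (2 : ℝ) • k := by rw [two_smul]; abel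
    rw [h4, h5, hsmul z 2 (by norm_num)] at h3
    rw [map_add (grad F z)] at h1 h2
    rw [map_neg (grad F z)] at h2
    unfold primalNorm at *
    linarith
  by_cases hh : h = 0
  · simp [hh, primalNorm]
  have hr : 0 < primalNorm (hess F x) h := Real.sqrt_pos.2 (hF.hess_pos hK hx hh)
  have hr2 : primalNorm (hess F x) h ^ 2 = hess F x h h := Real.sq_sqrt (hF.hess_nonneg hx h)
  have hθ : ∀ θ ∈ Ioo (0 : ℝ) 1,
      θ * primalNorm (hess F z) h ≤ -grad F z x * primalNorm (hess F x) h := by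
    intro θ hθ
    have h1 := hball ((θ / primalNorm (hess F x) h) • h) (by
      simp only [map_smul, smul_apply, smul_eq_mul]
      rw [← hr2]
      field_simp
      nlinarith [hθ.1, hθ.2])
    rw [hsmul z _ (div_nonneg hθ.1.le hr.le), div_mul_eq_mul_div, div_le_iff₀ hr] at h1
    exact h1
  have hlim : Tendsto (fun θ : ℝ => θ * primalNorm (hess F z) h) (𝓝[<] 1)
      (𝓝 (1 * primalNorm (hess F z) h)) :=
    ((continuous_id.mul continuous_const).tendsto 1).mono_left nhdsWithin_le_nhds
  rw [one_mul] at hlim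
  refine le_of_tendsto hlim ?_
  filter_upwards [Ioo_mem_nhdsLT (zero_lt_one (α := ℝ))] with θ h using hθ θ h

end IsNormalBarrier

/-! ### The dual cone and its interior -/

section DualCone

variable {E : Type*} [NormedAddCommGroup E] [NormedSpace ℝ E] {K : ProperCone ℝ E}

theorem convex_dualCone : Convex ℝ (dualCone K) := by
  intro s hs t ht a b ha hb _ x hx
  simp only [add_apply, smul_apply, smul_eq_mul]
  exact add_nonneg (mul_nonneg ha (hs x hx)) (mul_nonneg hb (ht x hx))

open scoped Pointwise in
theorem add_mem_interior_dualCone {s u : StrongDual ℝ E} (hs : s ∈ interior (dualCone K))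
    (hu : u ∈ dualCone K) : s + u ∈ interior (dualCone K) := by
  have h1 : interior (dualCone K) + {u} ⊆ dualCone K := by
    rintro _ ⟨a, ha, b, rfl, rfl⟩ x hx
    exact add_nonneg (interior_subset ha x hx) (hu x hx)
  exact interior_maximal h1 isOpen_interior.add_right ⟨s, hs, u, rfl, rfl⟩

open scoped Pointwise in
theorem smul_mem_interior_dualCone {s : StrongDual ℝ E} (hs : s ∈ interior (dualCone K)) {τ : ℝ}
    (hτ : 0 < τ) : τ • s ∈ interior (dualCone K) := by
  have h1 : τ • interior (dualCone K) ⊆ dualCone K := by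
    rintro _ ⟨a, ha, rfl⟩ x hx
    exact mul_nonneg hτ.le (interior_subset ha x hx)
  exact interior_maximal h1 (isOpen_interior.smul₀ hτ.ne') ⟨s, hs, rfl⟩

/-- Subtracting from `s` a small multiple of a functional norming `x` stays in the dual cone, so `s`
grows linearly on `K`. This provides coercivity. -/
theorem exists_pos_mul_norm_le {s : StrongDual ℝ E} (hs : s ∈ interior (dualCone K)) :
    ∃ ε : ℝ, 0 < ε ∧ ∀ x ∈ K, ε * ‖x‖ ≤ s x := by
  obtain ⟨δ, hδ, hball⟩ := Metric.isOpen_iff.1 isOpen_interior s hs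
  refine ⟨δ / 2, by positivity, fun x hx => ?_⟩
  obtain ⟨φ, hφ, hφx⟩ := exists_dual_vector'' ℝ x
  have hmem : s - (δ / 2) • φ ∈ dualCone K := by
    refine interior_subset (hball ?_)
    rw [Metric.mem_ball, dist_eq_norm, sub_sub_cancel_left, norm_neg, norm_smul,
      Real.norm_of_nonneg (by positivity)]
    nlinarith [norm_nonneg φ]
  have h1 := hmem x hx
  rw [sub_apply, smul_apply, smul_eq_mul, hφx] at h1
  simpa using h1

theorem dual_segment_mem {s σ : StrongDual ℝ E} (hs : s ∈ interior (dualCone K))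
    (hσ : σ ∈ interior (dualCone K)) :
    ∀ t ∈ Icc (0 : ℝ) 1, s + t • (σ - s) ∈ interior (dualCone K) := fun _ ht =>
  convex_dualCone.interior.add_smul_sub_mem hs hσ ht

end DualCone

/-! ### Existence of minimizers and the gradient map -/

namespace IsNormalBarrier

variable {E : Type*} [NormedAddCommGroup E] [NormedSpace ℝ E]
  {K : ProperCone ℝ E} {F : E → ℝ} {ν : ℝ}

/-- Minimization of `⟨s, x⟩ + F(x)` on a closed set that meets the interior of the cone. -/
theorem exists_min [FiniteDimensional ℝ E] (hF : IsNormalBarrier K F ν) {s : StrongDual ℝ E}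
    (hs : s ∈ interior (dualCone K)) {S : Set E} (hS : IsClosed S) {x₀ : E} (hx₀S : x₀ ∈ S)
    (hx₀ : x₀ ∈ interior (K : Set E)) :
    ∃ x ∈ S ∩ interior (K : Set E), ∀ z ∈ S ∩ interior (K : Set E), s x + F x ≤ s z + F z := by
  obtain ⟨ε, hε, hsε⟩ := exists_pos_mul_norm_le hs
  have hcontF : ContinuousOn (fun x => s x + F x) (interior (K : Set E)) :=
    s.continuous.continuousOn.add hF.contDiffOn.continuousOn
  let L : Set E := {x | x ∈ S ∩ interior (K : Set E) ∧ s x + F x ≤ s x₀ + F x₀}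
  have hbdd : Bornology.IsBounded L := by
    -- The tangent inequality at `x₀` is tested at `τ⁻¹x`: this reduces the slope of the lower bound
    -- on `F` to at most `ε/2`, which the growth `ε‖x‖` of `s` dominates, at the price of a constant
    -- `ν log τ`.
    let τ := 2 * (‖grad F x₀‖ + 1) / ε
    have hτ : 0 < τ := by positivity
    refine isBounded_iff_forall_norm_le.2
      ⟨2 / ε * (s x₀ + grad F x₀ x₀ + ν * Real.log τ), fun x hx => ?_⟩
    have h1 := hF.add_grad_le hx₀ (smul_mem_interior hx.1.2 (inv_pos.2 hτ))
    rw [hF.logHomogeneous x hx.1.2 _ (inv_pos.2 hτ), Real.log_inv, map_sub, map_smul,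
      smul_eq_mul] at h1
    have h2 := hsε x (interior_subset hx.1.2)
    have h3 : -(‖grad F x₀‖ * ‖x‖) ≤ grad F x₀ x :=
      (abs_le.1 ((grad F x₀).le_opNorm x)).1
    have h4 : τ⁻¹ * ‖grad F x₀‖ ≤ ε / 2 := by
      rw [inv_mul_le_iff₀ hτ]
      simp only [τ]
      rw [div_mul_div_comm, le_div_iff₀ (by positivity)]
      nlinarith [norm_nonneg (grad F x₀)]
    have h5 := mul_le_mul_of_nonneg_left h3 (inv_nonneg.2 hτ.le)
    have h6 := mul_le_mul_of_nonneg_right h4 (norm_nonneg x)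
    have h7 := hx.2
    rw [div_mul_eq_mul_div, le_div_iff₀ hε]
    linarith
  have hclosed : IsClosed L := by
    refine isClosed_of_closure_subset fun z hz => ?_
    have hne : (𝓝[L] z).NeBot := mem_closure_iff_nhdsWithin_neBot.1 hz
    have hzS : z ∈ S := closure_minimal (fun x hx => hx.1.1) hS hz
    have hzK : z ∈ closure (K : Set E) := closure_mono (fun x hx => interior_subset hx.1.2) hz
    have hzU : z ∈ interior (K : Set E) := by
      by_contra hn
      have h1 := (hF.tendsto_boundary z ⟨hzK, hn⟩).mono_left
        (nhdsWithin_mono z fun x (hx : x ∈ L) => hx.1.2)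
      obtain ⟨x, hx1, hx2⟩ := ((h1.eventually_gt_atTop (s x₀ + F x₀)).and
        self_mem_nhdsWithin).exists
      have h2 := hsε x (interior_subset hx2.1.2)
      have h3 := hx2.2
      have h4 := mul_nonneg hε.le (norm_nonneg x)
      linarith
    refine ⟨⟨hzS, hzU⟩, ?_⟩
    have h1 : Tendsto (fun x => s x + F x) (𝓝[L] z) (𝓝 (s z + F z)) :=
      (hcontF z hzU).mono_left (nhdsWithin_mono z fun x (hx : x ∈ L) => hx.1.2)
    exact le_of_tendsto h1 (eventually_nhdsWithin_of_forall fun x hx => hx.2)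
  obtain ⟨x, hxL, hmin⟩ := (Metric.isCompact_of_isClosed_isBounded hclosed hbdd).exists_isMinOn
    ⟨x₀, ⟨hx₀S, hx₀⟩, le_rfl⟩ (hcontF.mono fun x hx => hx.1.2)
  refine ⟨x, hxL.1, fun z hz => ?_⟩
  by_cases hzL : s z + F z ≤ s x₀ + F x₀
  · exact hmin (⟨hz, hzL⟩ : z ∈ L)
  · exact hxL.2.trans (not_le.1 hzL).le

/-- First-order optimality along a direction in which both `h` and `-h` are feasible. -/
theorem add_grad_eq_zero (hF : IsNormalBarrier K F ν) {s : StrongDual ℝ E} {S : Set E} {x h : E}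
    (hx : x ∈ interior (K : Set E)) (hS : ∀ t : ℝ, x + t • h ∈ S)
    (hmin : ∀ z ∈ S ∩ interior (K : Set E), s x + F x ≤ s z + F z) :
    s h + grad F x h = 0 := by
  have h1 : HasDerivAt (fun t : ℝ => s (x + t • h) + F (x + t • h)) (s h + grad F x h) 0 := by
    have h2 := hF.hasDerivAt_line (x := x) (h := h) (t := 0) (by simpa using hx)
    have h3 : HasDerivAt (fun t : ℝ => s (x + t • h)) (s h) 0 :=
      s.hasFDerivAt.comp_hasDerivAt 0 (ConicIPM.hasDerivAt_line x h 0)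
    rw [zero_smul, add_zero] at h2
    exact h3.add h2
  refine IsLocalMin.hasDerivAt_eq_zero ?_ h1
  have h2 : ∀ᶠ t : ℝ in 𝓝 0, x + t • h ∈ interior (K : Set E) := by
    have : Tendsto (fun t : ℝ => x + t • h) (𝓝 0) (𝓝 (x + (0 : ℝ) • h)) :=
      (ConicIPM.hasDerivAt_line x h 0).continuousAt
    rw [zero_smul, add_zero] at this
    exact this.eventually (isOpen_interior.mem_nhds hx)
  filter_upwards [h2] with t ht
  simpa using hmin _ ⟨hS t, ht⟩

theorem exists_grad_eq [FiniteDimensional ℝ E] (hF : IsNormalBarrier K F ν) (hK : IsRegular K)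
    {s : StrongDual ℝ E} (hs : s ∈ interior (dualCone K)) :
    ∃ x ∈ interior (K : Set E), grad F x = -s := by
  obtain ⟨x₀, hx₀⟩ := hK.interior_nonempty
  obtain ⟨x, hx, hmin⟩ := hF.exists_min hs isClosed_univ (mem_univ x₀) hx₀
  refine ⟨x, hx.2, ContinuousLinearMap.ext fun h => ?_⟩
  have := hF.add_grad_eq_zero (h := h) hx.2 (fun t => mem_univ _) hmin
  rw [neg_apply]
  linarith

theorem segment_mem (x z : E) (hx : x ∈ interior (K : Set E)) (hz : z ∈ interior (K : Set E)) :
    ∀ t ∈ Icc (0 : ℝ) 1, x + t • (z - x) ∈ interior (K : Set E) := fun _ ht =>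
  K.convex.interior.add_smul_sub_mem hx hz ht

theorem growth (hF : IsNormalBarrier K F ν) {x z : E} (hx : x ∈ interior (K : Set E))
    (hz : z ∈ interior (K : Set E)) :
    hess F x (z - x) (z - x) / (1 + √(hess F x (z - x) (z - x))) ≤
      grad F z (z - x) - grad F x (z - x) := by
  have hin := segment_mem x z hx hz
  have := growth_of_abs_deriv_le zero_le_one
    (fun t ht => hF.hasDerivAt_grad_line (hin t ht) (z - x))
    (fun t ht => hF.hasDerivAt_hess_line (hin t ht) (z - x) (z - x))
    (fun t ht => hF.hess_nonneg (hin t ht) (z - x)) (fun t ht => hF.abs_third_le (hin t ht) (z - x))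
  simpa using this

theorem grad_injOn (hF : IsNormalBarrier K F ν) (hK : IsRegular K) :
    InjOn (grad F) (interior (K : Set E)) := by
  intro x hx z hz hxz
  by_contra hne
  have h1 := hF.hess_pos hK hx (sub_ne_zero.2 (Ne.symm hne))
  have h2 := hF.growth hx hz
  rw [hxz, sub_self] at h2
  exact absurd h2 (not_le.2 (by positivity))

theorem exists_equiv [FiniteDimensional ℝ E] (hF : IsNormalBarrier K F ν) (hK : IsRegular K) {x : E}
    (hx : x ∈ interior (K : Set E)) :
    ∃ e : E ≃L[ℝ] StrongDual ℝ E, (e : E →L[ℝ] StrongDual ℝ E) = hess F x :=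
  exists_equiv_of_pos fun _ hu => hF.hess_pos hK hx hu

/-- The Hessian is invertible, so `∇F` maps neighbourhoods of `x` onto neighbourhoods of `∇F(x)`;
all nearby functionals are thus gradients, and `-∇F` takes values in the dual cone. -/
theorem neg_grad_mem [FiniteDimensional ℝ E] (hF : IsNormalBarrier K F ν) (hK : IsRegular K) {x : E}
    (hx : x ∈ interior (K : Set E)) : -grad F x ∈ interior (dualCone K) := by
  have := FiniteDimensional.complete ℝ E
  obtain ⟨e, he⟩ := hF.exists_equiv hK hx
  have h1 := hF.hasStrictFDerivAt_grad hx
  rw [← he] at h1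
  have h2 : grad F '' interior (K : Set E) ∈ 𝓝 (grad F x) := by
    rw [← h1.map_nhds_eq_of_equiv]
    exact image_mem_map (isOpen_interior.mem_nhds hx)
  rw [mem_interior_iff_mem_nhds]
  have h3 : Tendsto (fun s : StrongDual ℝ E => -s) (𝓝 (-grad F x)) (𝓝 (grad F x)) := by
    simpa using (continuous_neg (G := StrongDual ℝ E)).tendsto (-grad F x)
  filter_upwards [h3 h2] with s hs
  obtain ⟨z, hz, hzs⟩ := hs
  intro h hh
  have h4 := hF.grad_nonpos hK hz hh
  rw [hzs, neg_apply] at h4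
  linarith

end IsNormalBarrier

/-! ### The Legendre transform and the derivatives of the dual barrier -/

section Legendre

variable {E : Type*} [NormedAddCommGroup E] [NormedSpace ℝ E]

/-- The point of the interior of the cone at which the gradient of the barrier is `-s`. -/
noncomputable def legendrePoint (K : ProperCone ℝ E) (F : E → ℝ) (s : StrongDual ℝ E) : E :=
  Classical.epsilon fun x => x ∈ interior (K : Set E) ∧ grad F x = -s

theorem hess_apply_eq_dualHess [FiniteDimensional ℝ E] (Φ : StrongDual ℝ E → ℝ)
    (s u v : StrongDual ℝ E) : hess Φ s u v = v (dualHess Φ s u) := by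
  have h1 : bidualEquiv E (dualHess Φ s u) = hess Φ s u :=
    (bidualEquiv E).apply_symm_apply _
  rw [← h1]
  rfl

end Legendre

namespace IsNormalBarrier

variable {E : Type*} [NormedAddCommGroup E] [NormedSpace ℝ E]
  {K : ProperCone ℝ E} {F : E → ℝ} {ν : ℝ}

theorem legendrePoint_eq (hF : IsNormalBarrier K F ν) (hK : IsRegular K) {s : StrongDual ℝ E}
    {x : E} (hx : x ∈ interior (K : Set E)) (hs : grad F x = -s) : legendrePoint K F s = x := by
  have h := Classical.epsilon_spec
    (p := fun x => x ∈ interior (K : Set E) ∧ grad F x = -s) ⟨x, hx, hs⟩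
  exact hF.grad_injOn hK h.1 hx (h.2.trans hs.symm)

variable [FiniteDimensional ℝ E]

theorem legendrePoint_mem (hF : IsNormalBarrier K F ν) (hK : IsRegular K) {s : StrongDual ℝ E}
    (hs : s ∈ interior (dualCone K)) : legendrePoint K F s ∈ interior (K : Set E) := by
  obtain ⟨x, hx, hxs⟩ := hF.exists_grad_eq hK hs
  rwa [hF.legendrePoint_eq hK hx hxs]

theorem grad_legendrePoint (hF : IsNormalBarrier K F ν) (hK : IsRegular K) {s : StrongDual ℝ E}
    (hs : s ∈ interior (dualCone K)) : grad F (legendrePoint K F s) = -s := by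
  obtain ⟨x, hx, hxs⟩ := hF.exists_grad_eq hK hs
  rwa [hF.legendrePoint_eq hK hx hxs]

/-- Injectivity of `∇F` identifies the Legendre point near `s` with the local inverse of `∇F` at
`-s`. -/
theorem hasFDerivAt_legendrePoint (hF : IsNormalBarrier K F ν) (hK : IsRegular K)
    {s : StrongDual ℝ E} (hs : s ∈ interior (dualCone K)) {e : E ≃L[ℝ] StrongDual ℝ E}
    (he : (e : E →L[ℝ] StrongDual ℝ E) = hess F (legendrePoint K F s)) :
    HasFDerivAt (legendrePoint K F) (-(e.symm : StrongDual ℝ E →L[ℝ] E)) s := by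
  have := FiniteDimensional.complete ℝ E
  have hx := hF.legendrePoint_mem hK hs
  have hgx := hF.grad_legendrePoint hK hs
  set x := legendrePoint K F s with hxdef
  have h1 := hF.hasStrictFDerivAt_grad hx
  rw [← he] at h1
  have hneg : HasFDerivAt (fun s : StrongDual ℝ E => -s)
      (-ContinuousLinearMap.id ℝ (StrongDual ℝ E)) s := (hasFDerivAt_id s).neg
  have htend : Tendsto (fun s : StrongDual ℝ E => -s) (𝓝 s) (𝓝 (grad F x)) := by
    rw [hgx]; exact continuous_neg.tendsto s
  have hinv : HasFDerivAt (h1.localInverse (grad F) e x) (e.symm : StrongDual ℝ E →L[ℝ] E) (-s) := by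
    rw [← hgx]; exact h1.to_localInverse.hasFDerivAt
  have hcomp : HasFDerivAt (fun s' : StrongDual ℝ E => h1.localInverse (grad F) e x (-s'))
      (-(e.symm : StrongDual ℝ E →L[ℝ] E)) s := by
    have := hinv.comp s hneg
    refine this.congr_fderiv ?_
    ext u
    simp
  refine hcomp.congr_of_eventuallyEq ?_
  have hmem : ∀ᶠ σ in 𝓝 (grad F x), h1.localInverse (grad F) e x σ ∈ interior (K : Set E) := by
    have h2 := h1.localInverse_continuousAt
    refine h2.eventually (isOpen_interior.mem_nhds ?_)
    rw [h1.localInverse_apply_image]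
    exact hx
  filter_upwards [htend.eventually hmem, htend.eventually h1.eventually_right_inverse] with σ h2 h3
  exact hF.legendrePoint_eq hK h2 h3

theorem dualBarrier_eq (hF : IsNormalBarrier K F ν) (hK : IsRegular K) {s : StrongDual ℝ E}
    (hs : s ∈ interior (dualCone K)) :
    dualBarrier K F s = -s (legendrePoint K F s) - F (legendrePoint K F s) := by
  have hx := hF.legendrePoint_mem hK hs
  refine IsGreatest.csSup_eq ⟨⟨_, hx, rfl⟩, ?_⟩
  rintro _ ⟨z, hz, rfl⟩
  have h1 := hF.add_grad_le hx hz
  rw [hF.grad_legendrePoint hK hs, neg_apply, map_sub] at h1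
  simp only
  linarith

/-- Envelope argument: the contributions from the motion of the maximizer cancel because `∇F = -s`
there. -/
theorem hasFDerivAt_dualBarrier (hF : IsNormalBarrier K F ν) (hK : IsRegular K)
    {s : StrongDual ℝ E} (hs : s ∈ interior (dualCone K)) :
    HasFDerivAt (dualBarrier K F)
      (-(NormedSpace.inclusionInDoubleDual ℝ E (legendrePoint K F s))) s := by
  have hx := hF.legendrePoint_mem hK hs
  obtain ⟨e, he⟩ := hF.exists_equiv hK hx
  have h1 := hF.hasFDerivAt_legendrePoint hK hs he
  have h2 : HasFDerivAt (fun s : StrongDual ℝ E => -s (legendrePoint K F s) -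
      F (legendrePoint K F s)) _ s :=
    ((hasFDerivAt_id s).clm_apply h1).neg.sub ((hF.hasFDerivAt hx).comp s h1)
  have h3 : dualBarrier K F =ᶠ[𝓝 s] fun s : StrongDual ℝ E => -s (legendrePoint K F s) -
      F (legendrePoint K F s) := by
    filter_upwards [isOpen_interior.mem_nhds hs] with σ hσ using hF.dualBarrier_eq hK hσ
  refine (h2.congr_of_eventuallyEq h3).congr_fderiv ?_
  ext u
  simp [hF.grad_legendrePoint hK hs]

theorem grad_dualBarrier (hF : IsNormalBarrier K F ν) (hK : IsRegular K)
    {s : StrongDual ℝ E} (hs : s ∈ interior (dualCone K)) :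
    grad (dualBarrier K F) s = -(NormedSpace.inclusionInDoubleDual ℝ E (legendrePoint K F s)) :=
  (hF.hasFDerivAt_dualBarrier hK hs).fderiv

theorem dualHess_eq_symm (hF : IsNormalBarrier K F ν) (hK : IsRegular K)
    {s : StrongDual ℝ E} (hs : s ∈ interior (dualCone K)) {e : E ≃L[ℝ] StrongDual ℝ E}
    (he : (e : E →L[ℝ] StrongDual ℝ E) = hess F (legendrePoint K F s)) (u : StrongDual ℝ E) :
    dualHess (dualBarrier K F) s u = e.symm u := by
  have h1 := hF.hasFDerivAt_legendrePoint hK hs he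
  have h2 : HasFDerivAt (fun s : StrongDual ℝ E =>
      -(NormedSpace.inclusionInDoubleDual ℝ E (legendrePoint K F s)))
      (-((NormedSpace.inclusionInDoubleDual ℝ E).comp
        (-(e.symm : StrongDual ℝ E →L[ℝ] E)))) s :=
    (HasFDerivAt.comp (g := NormedSpace.inclusionInDoubleDual ℝ E) s
      (NormedSpace.inclusionInDoubleDual ℝ E).hasFDerivAt h1).neg
  have h3 : grad (dualBarrier K F) =ᶠ[𝓝 s] fun s : StrongDual ℝ E =>
      -(NormedSpace.inclusionInDoubleDual ℝ E (legendrePoint K F s)) := by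
    filter_upwards [isOpen_interior.mem_nhds hs] with σ hσ using hF.grad_dualBarrier hK hσ
  have h4 : hess (dualBarrier K F) s = _ := (h2.congr_of_eventuallyEq h3).fderiv
  apply (bidualEquiv E).injective
  have h5 : bidualEquiv E (dualHess (dualBarrier K F) s u) = hess (dualBarrier K F) s u :=
    (bidualEquiv E).apply_symm_apply _
  rw [h5, h4]
  ext v
  simp [bidualEquiv]

theorem hess_dualHess (hF : IsNormalBarrier K F ν) (hK : IsRegular K)
    {s : StrongDual ℝ E} (hs : s ∈ interior (dualCone K)) (u : StrongDual ℝ E) :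
    hess F (legendrePoint K F s) (dualHess (dualBarrier K F) s u) = u := by
  obtain ⟨e, he⟩ := hF.exists_equiv hK (hF.legendrePoint_mem hK hs)
  rw [hF.dualHess_eq_symm hK hs he, ← he]
  exact e.apply_symm_apply u

theorem dualHess_hess (hF : IsNormalBarrier K F ν) (hK : IsRegular K)
    {s : StrongDual ℝ E} (hs : s ∈ interior (dualCone K)) (h : E) :
    dualHess (dualBarrier K F) s (hess F (legendrePoint K F s) h) = h := by
  obtain ⟨e, he⟩ := hF.exists_equiv hK (hF.legendrePoint_mem hK hs)
  rw [hF.dualHess_eq_symm hK hs he, ← he]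
  exact e.symm_apply_apply h

theorem apply_dualHess (hF : IsNormalBarrier K F ν) (hK : IsRegular K)
    {s : StrongDual ℝ E} (hs : s ∈ interior (dualCone K)) (u v : StrongDual ℝ E) :
    v (dualHess (dualBarrier K F) s u) = hess F (legendrePoint K F s)
      (dualHess (dualBarrier K F) s v) (dualHess (dualBarrier K F) s u) := by
  rw [hF.hess_dualHess hK hs]

theorem hess_dualBarrier_symm (hF : IsNormalBarrier K F ν) (hK : IsRegular K)
    {s : StrongDual ℝ E} (hs : s ∈ interior (dualCone K)) (u v : StrongDual ℝ E) :
    hess (dualBarrier K F) s u v = hess (dualBarrier K F) s v u := by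
  rw [hess_apply_eq_dualHess, hess_apply_eq_dualHess, hF.apply_dualHess hK hs,
    hF.hess_symm (hF.legendrePoint_mem hK hs), ← hF.apply_dualHess hK hs]

theorem hess_dualBarrier_nonneg (hF : IsNormalBarrier K F ν) (hK : IsRegular K)
    {s : StrongDual ℝ E} (hs : s ∈ interior (dualCone K)) (u : StrongDual ℝ E) :
    0 ≤ hess (dualBarrier K F) s u u := by
  rw [hess_apply_eq_dualHess, hF.apply_dualHess hK hs]
  exact hF.hess_nonneg (hF.legendrePoint_mem hK hs) _

theorem hess_dualBarrier_pos (hF : IsNormalBarrier K F ν) (hK : IsRegular K)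
    {s : StrongDual ℝ E} (hs : s ∈ interior (dualCone K)) {u : StrongDual ℝ E} (hu : u ≠ 0) :
    0 < hess (dualBarrier K F) s u u := by
  rw [hess_apply_eq_dualHess, hF.apply_dualHess hK hs]
  refine hF.hess_pos hK (hF.legendrePoint_mem hK hs) fun h0 => hu ?_
  rw [← hF.hess_dualHess hK hs u, h0, map_zero]

/-! ### Self-concordance of the dual barrier along lines -/

theorem hasDerivAt_legendrePoint_line (hF : IsNormalBarrier K F ν) (hK : IsRegular K)
    {s d : StrongDual ℝ E} {t : ℝ} (hs : s + t • d ∈ interior (dualCone K)) :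
    HasDerivAt (fun t : ℝ => legendrePoint K F (s + t • d))
      (-(dualHess (dualBarrier K F) (s + t • d) d)) t := by
  obtain ⟨e, he⟩ := hF.exists_equiv hK (hF.legendrePoint_mem hK hs)
  rw [hF.dualHess_eq_symm hK hs he]
  exact (hF.hasFDerivAt_legendrePoint hK hs he).comp_hasDerivAt t
    (ConicIPM.hasDerivAt_line s d t)

/-- Let `M(t)` be the Hessian of `F` at the Legendre point and `w(t) = M(t)⁻¹u`. Differentiating `M
w = u` and pairing with `w` gives `⟨u, w'⟩ = -⟨M'w, w⟩`; the sign cancels against that of the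
derivative of the Legendre point. -/
theorem hasDerivAt_hess_dualBarrier_line (hF : IsNormalBarrier K F ν) (hK : IsRegular K)
    {s d : StrongDual ℝ E} {t : ℝ} (hs : s + t • d ∈ interior (dualCone K))
    (u : StrongDual ℝ E) :
    HasDerivAt (fun t : ℝ => hess (dualBarrier K F) (s + t • d) u u)
      (fderiv ℝ (hess F) (legendrePoint K F (s + t • d))
        (dualHess (dualBarrier K F) (s + t • d) d) (dualHess (dualBarrier K F) (s + t • d) u)
        (dualHess (dualBarrier K F) (s + t • d) u)) t := by
  have := FiniteDimensional.complete ℝ E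
  have hx := hF.legendrePoint_mem hK hs
  obtain ⟨e, he⟩ := hF.exists_equiv hK hx
  have hM : HasDerivAt (fun t : ℝ => hess F (legendrePoint K F (s + t • d)))
      (fderiv ℝ (hess F) (legendrePoint K F (s + t • d))
        (-(dualHess (dualBarrier K F) (s + t • d) d))) t :=
    HasFDerivAt.comp_hasDerivAt (l := hess F) t (hF.hasFDerivAt_hess hx)
      (hF.hasDerivAt_legendrePoint_line hK hs)
  have hev : ∀ᶠ r : ℝ in 𝓝 t, s + r • d ∈ interior (dualCone K) := by
    have : Tendsto (fun r : ℝ => s + r • d) (𝓝 t) (𝓝 (s + t • d)) :=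
      (ConicIPM.hasDerivAt_line s d t).continuousAt
    exact this.eventually (isOpen_interior.mem_nhds hs)
  obtain ⟨w', hw⟩ : ∃ w' : E,
      HasDerivAt (fun r : ℝ => dualHess (dualBarrier K F) (s + r • d) u) w' t := by
    have h1 : DifferentiableAt ℝ
        (ContinuousLinearMap.inverse : (E →L[ℝ] StrongDual ℝ E) → (StrongDual ℝ E →L[ℝ] E))
        (hess F (legendrePoint K F (s + t • d))) := by
      rw [← he]
      exact (contDiffAt_map_inverse (n := 1) e).differentiableAt (by norm_num)
    have h2 := HasFDerivAt.comp_hasDerivAt (l := ContinuousLinearMap.inverse)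
      (f := fun t : ℝ => hess F (legendrePoint K F (s + t • d))) t h1.hasFDerivAt hM
    have h3 := HasFDerivAt.comp_hasDerivAt t
      (ContinuousLinearMap.apply ℝ E u).hasFDerivAt h2
    refine ⟨_, h3.congr_of_eventuallyEq ?_⟩
    filter_upwards [hev] with r hr
    obtain ⟨e', he'⟩ := hF.exists_equiv hK (hF.legendrePoint_mem hK hr)
    rw [hF.dualHess_eq_symm hK hr he']
    simp only [Function.comp_apply, ← he', ContinuousLinearMap.inverse_equiv]
    rfl
  have hconst : HasDerivAt (fun _ : ℝ => u) 0 t := hasDerivAt_const t u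
  have hprod := hM.clm_apply hw
  have h0 := hprod.unique (hconst.congr_of_eventuallyEq (by
    filter_upwards [hev] with r hr using hF.hess_dualHess hK hr u))
  have hd : HasDerivAt (fun r : ℝ => u (dualHess (dualBarrier K F) (s + r • d) u)) (u w') t :=
    u.hasFDerivAt.comp_hasDerivAt t hw
  have hval : u w' = fderiv ℝ (hess F) (legendrePoint K F (s + t • d))
        (dualHess (dualBarrier K F) (s + t • d) d) (dualHess (dualBarrier K F) (s + t • d) u)
        (dualHess (dualBarrier K F) (s + t • d) u) := by
    have h4 := congrArg (fun φ : StrongDual ℝ E =>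
      φ (dualHess (dualBarrier K F) (s + t • d) u)) h0
    simp only [add_apply, map_neg, neg_apply, zero_apply] at h4
    have h5 := hF.hess_symm hx w' (dualHess (dualBarrier K F) (s + t • d) u)
    rw [hF.hess_dualHess hK hs] at h5
    linarith
  rw [← hval]
  simpa only [hess_apply_eq_dualHess] using hd

/-- The map `u ↦ ∇²F_*(s)u` carries the local norm of `∇²F_*(s)` to that of `∇²F` at the Legendre
point, so the trilinear bound for `F` transfers. -/
theorem abs_third_dualHess_le (hF : IsNormalBarrier K F ν) (hK : IsRegular K)
    {s : StrongDual ℝ E} (hs : s ∈ interior (dualCone K)) (d u : StrongDual ℝ E) :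
    |fderiv ℝ (hess F) (legendrePoint K F s) (dualHess (dualBarrier K F) s d)
        (dualHess (dualBarrier K F) s u) (dualHess (dualBarrier K F) s u)| ≤
      2 * √(hess (dualBarrier K F) s d d) * hess (dualBarrier K F) s u u := by
  have hx := hF.legendrePoint_mem hK hs
  have := abs_trilinear_le (hF.third_symm_left hx) (hF.third_symm_right hx) (hF.hess_symm hx)
    (fun _ h => hF.hess_pos hK hx h) (hF.abs_third_le_rpow hx)
    (dualHess (dualBarrier K F) s d) (dualHess (dualBarrier K F) s u)
  rwa [← hF.apply_dualHess hK hs d d, ← hF.apply_dualHess hK hs u u,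
    ← hess_apply_eq_dualHess _ s d d, ← hess_apply_eq_dualHess _ s u u] at this

theorem abs_third_dualHess_self_le (hF : IsNormalBarrier K F ν) (hK : IsRegular K)
    {s : StrongDual ℝ E} (hs : s ∈ interior (dualCone K)) (d : StrongDual ℝ E) :
    |fderiv ℝ (hess F) (legendrePoint K F s) (dualHess (dualBarrier K F) s d)
        (dualHess (dualBarrier K F) s d) (dualHess (dualBarrier K F) s d)| ≤
      2 * (hess (dualBarrier K F) s d d * √(hess (dualBarrier K F) s d d)) := by
  have := hF.abs_third_dualHess_le hK hs d d
  linarith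

theorem hasDerivAt_neg_apply_legendrePoint (hF : IsNormalBarrier K F ν) (hK : IsRegular K)
    {s d : StrongDual ℝ E} {t : ℝ} (hs : s + t • d ∈ interior (dualCone K)) :
    HasDerivAt (fun t : ℝ => -d (legendrePoint K F (s + t • d)))
      (hess (dualBarrier K F) (s + t • d) d d) t := by
  have h1 : HasDerivAt (fun t : ℝ => d (legendrePoint K F (s + t • d)))
      (d (-(dualHess (dualBarrier K F) (s + t • d) d))) t :=
    d.hasFDerivAt.comp_hasDerivAt t (hF.hasDerivAt_legendrePoint_line hK hs)
  rw [hess_apply_eq_dualHess]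
  rw [map_neg] at h1
  exact h1.neg.congr_deriv (neg_neg _)

theorem dual_growth (hF : IsNormalBarrier K F ν) (hK : IsRegular K) {s σ : StrongDual ℝ E}
    (hs : s ∈ interior (dualCone K)) (hσ : σ ∈ interior (dualCone K)) :
    hess (dualBarrier K F) s (σ - s) (σ - s) /
        (1 + √(hess (dualBarrier K F) s (σ - s) (σ - s))) ≤
      (σ - s) (legendrePoint K F s - legendrePoint K F σ) := by
  have hin := dual_segment_mem hs hσ
  have := growth_of_abs_deriv_le zero_le_one
    (fun t ht => hF.hasDerivAt_neg_apply_legendrePoint hK (hin t ht))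
    (fun t ht => hF.hasDerivAt_hess_dualBarrier_line hK (hin t ht) (σ - s))
    (fun t ht => hF.hess_dualBarrier_nonneg hK (hin t ht) (σ - s))
    (fun t ht => hF.abs_third_dualHess_self_le hK (hin t ht) (σ - s))
  simp only [one_mul, zero_smul, add_zero, one_smul, add_sub_cancel] at this
  rw [map_sub (σ - s) (legendrePoint K F s)]
  linarith

/-- Along the ray `s + tu` the derivative of `F_*` is `-⟨u, x(s + tu)⟩ ≤ 0`, because Legendre points
lie in `K`. -/
theorem sqrt_hess_dualBarrier_le (hF : IsNormalBarrier K F ν) (hK : IsRegular K)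
    {s u : StrongDual ℝ E} (hs : s ∈ interior (dualCone K)) (hu : u ∈ dualCone K) :
    √(hess (dualBarrier K F) s u u) ≤ u (legendrePoint K F s) := by
  have hin : ∀ t : ℝ, 0 ≤ t → s + t • u ∈ interior (dualCone K) := fun t ht =>
    add_mem_interior_dualCone hs fun x hx => mul_nonneg ht (hu x hx)
  have := sqrt_le_neg_of_abs_deriv_le
    (fun t ht => hF.hasDerivAt_neg_apply_legendrePoint hK (hin t ht))
    (fun t ht => hF.hasDerivAt_hess_dualBarrier_line hK (hin t ht) u)
    (fun t ht => hF.hess_dualBarrier_nonneg hK (hin t ht) u)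
    (fun t ht => hF.abs_third_dualHess_self_le hK (hin t ht) u)
    (fun t ht => neg_nonpos.2 (hu _ (interior_subset (hF.legendrePoint_mem hK (hin t ht)))))
  simpa using this

theorem dual_compare (hF : IsNormalBarrier K F ν) (hK : IsRegular K) {s σ : StrongDual ℝ E}
    (hs : s ∈ interior (dualCone K)) (hσ : σ ∈ interior (dualCone K))
    (hρ : √(hess (dualBarrier K F) s (σ - s) (σ - s)) < 1) (u : StrongDual ℝ E) :
    (1 - √(hess (dualBarrier K F) s (σ - s) (σ - s))) ^ 2 * hess (dualBarrier K F) s u u ≤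
        hess (dualBarrier K F) σ u u ∧
      (1 - √(hess (dualBarrier K F) s (σ - s) (σ - s))) ^ 2 * hess (dualBarrier K F) σ u u ≤
        hess (dualBarrier K F) s u u := by
  have hin := dual_segment_mem hs hσ
  have := compare_of_abs_deriv_le
    (fun t ht => hF.hasDerivAt_hess_dualBarrier_line hK (hin t ht) (σ - s))
    (fun t ht => hF.hess_dualBarrier_nonneg hK (hin t ht) (σ - s))
    (fun t ht => hF.abs_third_dualHess_self_le hK (hin t ht) (σ - s))
    (fun t ht => hF.hasDerivAt_hess_dualBarrier_line hK (hin t ht) u)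
    (fun t ht => hF.hess_dualBarrier_nonneg hK (hin t ht) u)
    (fun t ht => hF.abs_third_dualHess_le hK (hin t ht) (σ - s) u)
    (by simpa using hρ)
  simpa using this

/-- Stability of the Hessian of the dual barrier, in the local norm of the primal space. -/
theorem primalNorm_dualHess_sub_le (hF : IsNormalBarrier K F ν) (hK : IsRegular K)
    {s σ : StrongDual ℝ E} (hs : s ∈ interior (dualCone K)) (hσ : σ ∈ interior (dualCone K))
    {ρ : ℝ} (hρ1 : ρ < 1) (hρ : √(hess (dualBarrier K F) s (σ - s) (σ - s)) ≤ ρ)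
    (u : StrongDual ℝ E) :
    primalNorm (hess F (legendrePoint K F σ))
        (dualHess (dualBarrier K F) s u - dualHess (dualBarrier K F) σ u) ≤
      (((1 - ρ) ^ 2)⁻¹ - 1) * √(hess (dualBarrier K F) σ u u) := by
  have hρ0 := (Real.sqrt_nonneg _).trans hρ
  have hpos : 0 < (1 - ρ) ^ 2 := pow_pos (by linarith) 2
  have hle1 : (1 - ρ) ^ 2 ≤ 1 := pow_le_one₀ (by linarith) (by linarith)
  set θ := (1 - ρ) ^ 2 with hθ
  have hθinv : 1 ≤ θ⁻¹ := (one_le_inv₀ hpos).2 hle1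
  -- This gives `1 - θ ≤ θ⁻¹ - 1`, so one constant serves for both signs of the Hessian difference.
  have hsum : 2 ≤ θ + θ⁻¹ := by
    have : θ * θ⁻¹ = 1 := mul_inv_cancel₀ hpos.ne'
    nlinarith
  have habs : ∀ u, |(hess (dualBarrier K F) s - hess (dualBarrier K F) σ) u u| ≤
      (θ⁻¹ - 1) * hess (dualBarrier K F) σ u u := by
    intro u
    have h1 := hF.dual_compare hK hs hσ (hρ.trans_lt hρ1) u
    have hm0 := hF.hess_dualBarrier_nonneg hK hs u
    have hm1 := hF.hess_dualBarrier_nonneg hK hσ u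
    have hθle : θ ≤ (1 - √(hess (dualBarrier K F) s (σ - s) (σ - s))) ^ 2 :=
      pow_le_pow_left₀ (by linarith) (by linarith) 2
    have h2 := (mul_le_mul_of_nonneg_right hθle hm0).trans h1.1
    have h3 := (mul_le_mul_of_nonneg_right hθle hm1).trans h1.2
    have h4 : hess (dualBarrier K F) s u u ≤ θ⁻¹ * hess (dualBarrier K F) σ u u := by
      rw [inv_mul_eq_div, le_div_iff₀ hpos]
      linarith
    simp only [sub_apply]
    rw [abs_le]
    constructor
    · nlinarith
    · linarith
  set d := dualHess (dualBarrier K F) s u - dualHess (dualBarrier K F) σ u with hd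
  -- The second argument is `∇²F(x(σ))d`: then both the mixed value and the quadratic form equal
  -- `‖d‖²`, and one factor cancels.
  have h1 := sq_le_of_abs_le (S := hess (dualBarrier K F) s - hess (dualBarrier K F) σ)
    (fun u v => by simp only [sub_apply, hF.hess_dualBarrier_symm hK hs u v,
      hF.hess_dualBarrier_symm hK hσ u v])
    (hF.hess_dualBarrier_symm hK hσ) habs u (hess F (legendrePoint K F σ) d)
  have hx := hF.legendrePoint_mem hK hσ
  have hdd := hF.hess_nonneg hx d
  have huu := hF.hess_dualBarrier_nonneg hK hσ u
  have h2 : (hess (dualBarrier K F) s - hess (dualBarrier K F) σ) u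
      (hess F (legendrePoint K F σ) d) = hess F (legendrePoint K F σ) d d := by
    simp only [sub_apply, hess_apply_eq_dualHess]
    rw [← map_sub, ← hd]
  have h3 : hess (dualBarrier K F) σ (hess F (legendrePoint K F σ) d)
      (hess F (legendrePoint K F σ) d) = hess F (legendrePoint K F σ) d d := by
    rw [hess_apply_eq_dualHess, hF.dualHess_hess hK hσ]
  rw [h2, h3] at h1
  unfold primalNorm
  rw [Real.sqrt_le_left (mul_nonneg (by linarith) (Real.sqrt_nonneg _)), mul_pow,
    Real.sq_sqrt huu]
  rcases hdd.eq_or_lt with h0 | h0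
  · rw [← h0]; positivity
  · nlinarith

end IsNormalBarrier

section DualNorm

variable {V : Type*} [NormedAddCommGroup V] [NormedSpace ℝ V] [FiniteDimensional ℝ V]

theorem abs_apply_le_dualNorm {T : V →L[ℝ] StrongDual ℝ V} (hsymm : ∀ u v, T u v = T v u)
    (hpos : ∀ u, u ≠ 0 → 0 < T u u) (g : StrongDual ℝ V) (k : V) :
    |g k| ≤ dualNorm T g * √(T k k) := by
  have hnn : ∀ u, 0 ≤ T u u := by
    intro u
    by_cases hu : u = 0
    · simp [hu]
    · exact (hpos u hu).le
  obtain ⟨e, rfl⟩ := exists_equiv_of_pos hpos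
  have h1 := cauchy_schwarz hsymm hnn (e.symm g) k
  unfold dualNorm
  rw [ContinuousLinearMap.inverse_equiv]
  simpa using h1

end DualNorm

/-! ### The conic problem and its central path -/

section Problem

variable {E : Type*} [NormedAddCommGroup E] [NormedSpace ℝ E]
  {H : Type*} [NormedAddCommGroup H] [NormedSpace ℝ H]
  {K : ProperCone ℝ E} {F : E → ℝ} {ν : ℝ} {A : E →L[ℝ] StrongDual ℝ H}
  {b : StrongDual ℝ H} {c : StrongDual ℝ E}

theorem flip_injective (hA : Function.Surjective A) : Function.Injective A.flip := by
  rw [injective_iff_map_eq_zero]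
  intro h hh
  refine SeparatingDual.eq_zero_of_forall_dual_eq_zero (R := ℝ) fun φ => ?_
  obtain ⟨x, rfl⟩ := hA φ
  rw [← ContinuousLinearMap.flip_apply, hh, zero_apply]

/-- A functional vanishing on the kernel of `A` factors through `A`; the factor is a point of `H` by
reflexivity. It supplies the Lagrange multiplier. -/
theorem exists_flip_eq [FiniteDimensional ℝ H] (hA : Function.Surjective A)
    {φ : StrongDual ℝ E} (hφ : ∀ h, A h = 0 → φ h = 0) : ∃ y, A.flip y = φ := by
  obtain ⟨r, hr⟩ := A.toLinearMap.exists_rightInverse_of_surjective (LinearMap.range_eq_top.2 hA)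
  have hr' : ∀ g, A (r g) = g := fun g => congrArg (fun f => f g) hr
  refine ⟨(bidualEquiv H).symm (LinearMap.toContinuousLinearMap (φ.toLinearMap ∘ₗ r)), ?_⟩
  ext x
  have h1 : ∀ g : StrongDual ℝ H,
      g ((bidualEquiv H).symm (LinearMap.toContinuousLinearMap (φ.toLinearMap ∘ₗ r))) =
        φ (r g) := by
    intro g
    have h2 := (bidualEquiv H).apply_symm_apply
      (LinearMap.toContinuousLinearMap (φ.toLinearMap ∘ₗ r))
    exact congrArg (fun f => f g) h2
  have h3 := hφ (r (A x) - x) (by rw [map_sub, hr', sub_self])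
  rw [map_sub, sub_eq_zero] at h3
  rw [ContinuousLinearMap.flip_apply, h1, h3]

/-- The central path exists. -/
theorem exists_isCentral [FiniteDimensional ℝ E] [FiniteDimensional ℝ H]
    (hF : IsNormalBarrier K F ν) (hA : Function.Surjective A) (hfeas : StrictlyFeasible K A b c)
    {μ : ℝ} (hμ : 0 < μ) : ∃ z, IsCentral K F A b c μ z := by
  obtain ⟨x₀, hx₀, s₀, hs₀, y₀, hAx₀, hs₀c⟩ := hfeas
  have hclosed : IsClosed {x | A x = b} := isClosed_eq A.continuous continuous_const
  -- On `A x = b` the functionals `s₀` and `c` differ by a constant, and `s₀` is coercive; the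
  -- multiplier is shifted back by `y₀` at the end.
  obtain ⟨x, hx, hmin⟩ := hF.exists_min (smul_mem_interior_dualCone hs₀ (inv_pos.2 hμ)) hclosed
    hAx₀ hx₀
  have hxb : A x = b := hx.1
  obtain ⟨y, hy⟩ := exists_flip_eq hA (φ := μ⁻¹ • s₀ + grad F x) fun h hh =>
    hF.add_grad_eq_zero hx.2 (fun t => by
      change A (x + t • h) = b
      rw [map_add, map_smul, hh, smul_zero, add_zero, hxb]) hmin
  refine ⟨(x, -(μ • grad F x), μ • y + y₀), hx.2, hxb, ?_, rfl⟩
  simp only [map_add, map_smul, hy, smul_add, smul_smul, mul_inv_cancel₀ hμ.ne', one_smul]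
  rw [← hs₀c]
  abel

theorem centralPath_spec [FiniteDimensional ℝ E] [FiniteDimensional ℝ H]
    (hF : IsNormalBarrier K F ν) (hA : Function.Surjective A) (hfeas : StrictlyFeasible K A b c)
    {μ : ℝ} (hμ : 0 < μ) : IsCentral K F A b c μ (centralPath K F A b c μ) :=
  Classical.epsilon_spec (exists_isCentral hF hA hfeas hμ)

theorem IsCentral.eq_slack {μ : ℝ} {z : E × StrongDual ℝ E × H} (hz : IsCentral K F A b c μ z) :
    z.2.1 = slack A c z.2.2 := by
  rw [hz.2.2.2, slack, ← hz.2.2.1]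
  abel

theorem IsCentral.mem_interior [FiniteDimensional ℝ E] (hF : IsNormalBarrier K F ν)
    (hK : IsRegular K) {μ : ℝ} (hμ : 0 < μ) {z : E × StrongDual ℝ E × H}
    (hz : IsCentral K F A b c μ z) : z.2.1 ∈ interior (dualCone K) := by
  have h1 : z.2.1 = μ • -grad F z.1 := by rw [hz.2.2.2]; exact (smul_neg _ _).symm
  rw [h1]
  exact smul_mem_interior_dualCone (hF.neg_grad_mem hK hz.1) hμ

theorem IsCentral.apply_self (hF : IsNormalBarrier K F ν) {μ : ℝ} {z : E × StrongDual ℝ E × H}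
    (hz : IsCentral K F A b c μ z) : z.2.1 z.1 = μ * ν := by
  rw [hz.2.2.2, neg_apply, smul_apply, hF.grad_self hz.1, smul_eq_mul]
  ring

theorem IsCentral.legendrePoint_eq (hF : IsNormalBarrier K F ν) (hK : IsRegular K) {μ : ℝ}
    (hμ : 0 < μ) {z : E × StrongDual ℝ E × H} (hz : IsCentral K F A b c μ z) :
    legendrePoint K F z.2.1 = μ⁻¹ • z.1 := by
  refine hF.legendrePoint_eq hK (smul_mem_interior hz.1 (inv_pos.2 hμ)) ?_
  rw [hF.grad_smul hz.1 (inv_pos.2 hμ), inv_inv, hz.2.2.2, neg_neg]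

theorem slack_sub_slack (y y' : H) : slack A c y - slack A c y' = A.flip (y' - y) := by
  rw [slack, slack, map_sub]
  abel

/-- For a dual optimal `s_*`, one has `⟨s_*, x_μ⟩ ≤ μν`. -/
theorem IsCentral.apply_le [FiniteDimensional ℝ E] (hF : IsNormalBarrier K F ν) (hK : IsRegular K)
    {μ : ℝ} (hμ : 0 < μ) {z : E × StrongDual ℝ E × H} (hz : IsCentral K F A b c μ z)
    {s : StrongDual ℝ E} {y : H} (hopt : IsDualOptimal K A b c s y) : s z.1 ≤ μ * ν := by
  have hfe : z.2.2 ∈ feasibleSet K A c := by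
    change slack A c z.2.2 ∈ dualCone K
    rw [← hz.eq_slack]
    exact interior_subset (hz.mem_interior hF hK hμ)
  have hs : s = slack A c y := by rw [slack, ← hopt.2.1]; abel
  have h1 : (s - z.2.1) z.1 = b z.2.2 - b y := by
    rw [hs, hz.eq_slack, slack_sub_slack, ContinuousLinearMap.flip_apply, hz.2.1, map_sub]
  rw [sub_apply, hz.apply_self hF] at h1
  linarith [hopt.2.2 _ hfe]

/-- The primal-dual pairing of two central points. -/
theorem IsCentral.apply_le_of_isCentral [FiniteDimensional ℝ E] (hF : IsNormalBarrier K F ν)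
    (hK : IsRegular K) {μ μ' : ℝ} (hμ' : 0 < μ') {z z' : E × StrongDual ℝ E × H}
    (hz : IsCentral K F A b c μ z) (hz' : IsCentral K F A b c μ' z') :
    z.2.1 z'.1 ≤ μ * ν + μ' * ν := by
  have h1 : (z.2.1 - z'.2.1) (z.1 - z'.1) = 0 := by
    rw [hz.eq_slack, hz'.eq_slack, slack_sub_slack, ContinuousLinearMap.flip_apply, map_sub A,
      hz.2.1, hz'.2.1, sub_self, zero_apply]
  have h2 : 0 ≤ z'.2.1 z.1 :=
    interior_subset (hz'.mem_interior hF hK hμ') _ (interior_subset hz.1)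
  rw [map_sub, sub_apply, sub_apply, hz.apply_self hF, hz'.apply_self hF] at h1
  linarith

/-- Continue slightly past `y`, away from the strictly feasible `y₀`, without leaving the feasible
set. The slack of `y` is then a convex combination of that feasible slack and the interior point
`s₀`, with positive weight on `s₀`. -/
theorem slack_mem_interior (hfeas : StrictlyFeasible K A b c) {y : H}
    (hy : y ∈ interior (feasibleSet K A c)) : slack A c y ∈ interior (dualCone K) := by
  obtain ⟨x₀, -, s₀, hs₀, y₀, -, hs₀c⟩ := hfeas
  have hs : s₀ = slack A c y₀ := by rw [slack, ← hs₀c]; abel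
  have htend : Tendsto (fun t : ℝ => y + t • (y - y₀)) (𝓝[>] 0) (𝓝 y) := by
    have h1 : Tendsto (fun t : ℝ => y + t • (y - y₀)) (𝓝 0) (𝓝 (y + (0 : ℝ) • (y - y₀))) :=
      (hasDerivAt_line y (y - y₀) 0).continuousAt
    rw [zero_smul, add_zero] at h1
    exact h1.mono_left nhdsWithin_le_nhds
  obtain ⟨t, ht, htpos⟩ := ((htend.eventually (mem_interior_iff_mem_nhds.1 hy)).and
    self_mem_nhdsWithin).exists
  have htpos' : (0 : ℝ) < t := htpos
  have h2 : slack A c y = (t / (1 + t)) • s₀ + (1 / (1 + t)) • slack A c (y + t • (y - y₀)) := by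
    rw [hs]
    simp only [slack, map_add, map_smul, map_sub]
    have : (1 + t) ≠ 0 := by positivity
    match_scalars <;> field_simp <;> ring
  rw [h2]
  exact convex_dualCone.combo_interior_self_mem_interior hs₀ ht (by positivity) (by positivity)
    (by field_simp; ring)

theorem optimalValue_eq {s : StrongDual ℝ E} {y : H} (hopt : IsDualOptimal K A b c s y) :
    optimalValue K A b c = b y := by
  refine IsGreatest.csSup_eq ⟨⟨y, ?_, rfl⟩, ?_⟩
  · change slack A c y ∈ dualCone K
    rw [slack, ← hopt.2.1, add_sub_cancel_right]
    exact hopt.1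
  · rintro _ ⟨y', hy', rfl⟩
    exact hopt.2.2 y' hy'

theorem hasFDerivAt_slack (y : H) : HasFDerivAt (slack A c) (-A.flip) y :=
  A.flip.hasFDerivAt.const_sub c

/-! ### Derivatives of the barrier of the feasible set -/

variable [FiniteDimensional ℝ E]

theorem grad_feasibleBarrier (hF : IsNormalBarrier K F ν) (hK : IsRegular K) {y : H}
    (hy : slack A c y ∈ interior (dualCone K)) :
    grad (feasibleBarrier K F A c) y = A (legendrePoint K F (slack A c y)) := by
  have h1 : HasFDerivAt (feasibleBarrier K F A c) _ y :=
    HasFDerivAt.comp (f := slack A c) y (hF.hasFDerivAt_dualBarrier hK hy) (hasFDerivAt_slack y)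
  unfold grad
  rw [h1.fderiv]
  ext k
  simp

theorem hess_feasibleBarrier (hF : IsNormalBarrier K F ν) (hK : IsRegular K) {y : H}
    (hy : slack A c y ∈ interior (dualCone K)) (h k : H) :
    hess (feasibleBarrier K F A c) y h k =
      hess (dualBarrier K F) (slack A c y) (A.flip h) (A.flip k) := by
  obtain ⟨e, he⟩ := hF.exists_equiv hK (hF.legendrePoint_mem hK hy)
  have h1 : HasFDerivAt (fun y => A (legendrePoint K F (slack A c y)))
      (A.comp ((-(e.symm : StrongDual ℝ E →L[ℝ] E)).comp (-A.flip))) y :=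
    HasFDerivAt.comp y A.hasFDerivAt
      (HasFDerivAt.comp (f := slack A c) y (hF.hasFDerivAt_legendrePoint hK hy he)
        (hasFDerivAt_slack y))
  have h2 : grad (feasibleBarrier K F A c) =ᶠ[𝓝 y]
      fun y => A (legendrePoint K F (slack A c y)) := by
    have h3 : Tendsto (slack A c) (𝓝 y) (𝓝 (slack A c y)) := (hasFDerivAt_slack y).continuousAt
    filter_upwards [h3.eventually (isOpen_interior.mem_nhds hy)] with z hz
      using grad_feasibleBarrier hF hK hz
  have h4 : hess (feasibleBarrier K F A c) y = _ := (h1.congr_of_eventuallyEq h2).fderiv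
  rw [h4, hess_apply_eq_dualHess, hF.dualHess_eq_symm hK hy he]
  simp

theorem hess_feasibleBarrier_symm (hF : IsNormalBarrier K F ν) (hK : IsRegular K) {y : H}
    (hy : slack A c y ∈ interior (dualCone K)) (h k : H) :
    hess (feasibleBarrier K F A c) y h k = hess (feasibleBarrier K F A c) y k h := by
  rw [hess_feasibleBarrier hF hK hy, hess_feasibleBarrier hF hK hy,
    hF.hess_dualBarrier_symm hK hy]

theorem hess_feasibleBarrier_pos (hF : IsNormalBarrier K F ν) (hK : IsRegular K)
    (hA : Function.Surjective A) {y : H} (hy : slack A c y ∈ interior (dualCone K)) (h : H)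
    (hh : h ≠ 0) : 0 < hess (feasibleBarrier K F A c) y h h := by
  rw [hess_feasibleBarrier hF hK hy]
  exact hF.hess_dualBarrier_pos hK hy ((map_ne_zero_iff _ (flip_injective hA)).2 hh)

/-! ### Estimates in the neighbourhood of the central path -/

variable [FiniteDimensional ℝ H]

theorem abs_apply_le_of_mem_neighborhood (hF : IsNormalBarrier K F ν) (hK : IsRegular K)
    (hA : Function.Surjective A) {μ β : ℝ} {y : H} (hs : slack A c y ∈ interior (dualCone K))
    (hy : y ∈ neighborhood K F A b c μ β) (k : H) :
    |A (legendrePoint K F (slack A c y)) k - μ⁻¹ * b k| ≤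
      β * √(hess (dualBarrier K F) (slack A c y) (A.flip k) (A.flip k)) := by
  have h1 := abs_apply_le_dualNorm (hess_feasibleBarrier_symm hF hK hs)
    (hess_feasibleBarrier_pos hF hK hA hs) (grad (feasibleBarrier K F A c) y - μ⁻¹ • b) k
  rw [hess_feasibleBarrier hF hK hs, sub_apply, smul_apply, smul_eq_mul] at h1
  have h2 := h1.trans (mul_le_mul_of_nonneg_right hy.2 (Real.sqrt_nonneg _))
  rwa [grad_feasibleBarrier hF hK hs] at h2

/-- Points of the neighbourhood are close to the central path in the local norm. -/
theorem sqrt_hess_sub_central_le (hF : IsNormalBarrier K F ν) (hK : IsRegular K)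
    (hA : Function.Surjective A) {μ β : ℝ} (hμ : 0 < μ) (hβ0 : 0 ≤ β) (hβ1 : β < 1)
    {z : E × StrongDual ℝ E × H} (hz : IsCentral K F A b c μ z) {y : H}
    (hs : slack A c y ∈ interior (dualCone K)) (hy : y ∈ neighborhood K F A b c μ β) :
    √(hess (dualBarrier K F) (slack A c y) (z.2.1 - slack A c y) (z.2.1 - slack A c y)) ≤
      β / (1 - β) := by
  have hzs := hz.mem_interior hF hK hμ
  have h1 := hF.dual_growth hK hs hzs
  have hd : z.2.1 - slack A c y = A.flip (y - z.2.2) := by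
    rw [hz.eq_slack, slack_sub_slack]
  have h2 := (abs_le.1 (abs_apply_le_of_mem_neighborhood hF hK hA hs hy (y - z.2.2))).2
  -- Since `x(s_μ) = x_μ/μ` and `A x_μ = b`, the pairing bounded below by `dual_growth` is exactly
  -- the residual controlled by the neighbourhood.
  have h3 : (z.2.1 - slack A c y) (legendrePoint K F (slack A c y) - legendrePoint K F z.2.1) =
      A (legendrePoint K F (slack A c y)) (y - z.2.2) - μ⁻¹ * b (y - z.2.2) := by
    rw [hd, ContinuousLinearMap.flip_apply, hz.legendrePoint_eq hF hK hμ, map_sub A, map_smul,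
      hz.2.1, sub_apply, smul_apply, smul_eq_mul]
  rw [← hd] at h2
  rw [h3] at h1
  have hr := Real.sqrt_nonneg
    (hess (dualBarrier K F) (slack A c y) (z.2.1 - slack A c y) (z.2.1 - slack A c y))
  have hr2 := Real.sq_sqrt (hF.hess_dualBarrier_nonneg hK hs (z.2.1 - slack A c y))
  set r := √(hess (dualBarrier K F) (slack A c y) (z.2.1 - slack A c y) (z.2.1 - slack A c y))
  rw [← hr2] at h1
  have h4 := h1.trans h2
  rw [div_le_iff₀ (by linarith)] at h4
  rw [le_div_iff₀ (by linarith)]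
  rcases hr.eq_or_lt with h0 | h0
  · rw [← h0]; linarith
  · have h5 : r * r ≤ r * (β * (1 + r)) := by linarith
    have h6 := le_of_mul_le_mul_left h5 h0
    linarith

theorem optimalValue_sub_le (hF : IsNormalBarrier K F ν) (hK : IsRegular K)
    (hA : Function.Surjective A) {μ β : ℝ} (hμ : 0 < μ) (hβ0 : 0 ≤ β) (hβ1 : β < 1)
    {z : E × StrongDual ℝ E × H} (hz : IsCentral K F A b c μ z) {y : H}
    (hs : slack A c y ∈ interior (dualCone K)) (hy : y ∈ neighborhood K F A b c μ β)
    {sStar : StrongDual ℝ E} {yStar : H} (hopt : IsDualOptimal K A b c sStar yStar) :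
    optimalValue K A b c - b y ≤ (ν + β * (β + √ν) / (1 - β)) * μ := by
  rw [optimalValue_eq hopt]
  have hx := hF.legendrePoint_mem hK hs
  have hρ := sqrt_hess_sub_central_le hF hK hA hμ hβ0 hβ1 hz hs hy
  have hd : z.2.1 - slack A c y = A.flip (y - z.2.2) := by
    rw [hz.eq_slack, slack_sub_slack]
  have h2 := (abs_le.1 (abs_apply_le_of_mem_neighborhood hF hK hA hs hy (y - z.2.2))).2
  rw [← hd] at h2
  have h3 : b yStar - b z.2.2 ≤ μ * ν := by
    have hss : sStar = slack A c yStar := by rw [slack, ← hopt.2.1]; abel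
    have h4 : (z.2.1 - sStar) z.1 = b yStar - b z.2.2 := by
      rw [hss, hz.eq_slack, slack_sub_slack, ContinuousLinearMap.flip_apply, hz.2.1, map_sub]
    rw [sub_apply, hz.apply_self hF] at h4
    linarith [hopt.1 _ (interior_subset hz.1)]
  -- Cauchy-Schwarz at the Legendre point, whose squared local norm is `ν`.
  have h5 : -(√(hess (dualBarrier K F) (slack A c y) (z.2.1 - slack A c y)
      (z.2.1 - slack A c y)) * √ν) ≤ A (legendrePoint K F (slack A c y)) (y - z.2.2) := by
    have h6 := cauchy_schwarz (hF.hess_symm hx) (hF.hess_nonneg hx)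
      (dualHess (dualBarrier K F) (slack A c y) (z.2.1 - slack A c y))
      (legendrePoint K F (slack A c y))
    rw [← hF.apply_dualHess hK hs, hF.hess_dualHess hK hs, hF.hess_self hx,
      ← hess_apply_eq_dualHess] at h6
    have h7 := (abs_le.1 h6).1
    rwa [congrArg (fun φ : StrongDual ℝ E => φ (legendrePoint K F (slack A c y))) hd,
      ContinuousLinearMap.flip_apply] at h7
  set r := √(hess (dualBarrier K F) (slack A c y) (z.2.1 - slack A c y) (z.2.1 - slack A c y))
  have h8 : μ⁻¹ * (b z.2.2 - b y) ≤ (β + √ν) * (β / (1 - β)) := by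
    have h9 : (β + √ν) * r ≤ (β + √ν) * (β / (1 - β)) :=
      mul_le_mul_of_nonneg_left hρ (by positivity)
    rw [map_sub b] at h2
    linarith
  rw [inv_mul_le_iff₀ hμ] at h8
  have h10 : (ν + β * (β + √ν) / (1 - β)) * μ = μ * ν + μ * ((β + √ν) * (β / (1 - β))) := by
    ring
  linarith

theorem inv_sq_sub_one_le {β : ℝ} (hβ0 : 0 ≤ β) (hβ : β ≤ 1 / 9) :
    ((1 - β / (1 - β)) ^ 2)⁻¹ - 1 ≤ 3 * β := by
  have h1 : 1 - β / (1 - β) = (1 - 2 * β) / (1 - β) := by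
    have : 1 - β ≠ 0 := by linarith
    field_simp
    ring
  have hpos : 0 < (1 - 2 * β) ^ 2 := pow_pos (by linarith) 2
  rw [h1, div_pow, inv_div, sub_le_iff_le_add, div_le_iff₀ hpos]
  -- After clearing denominators the difference of the two sides is `β(1 - 9β + 12β²)`; the
  -- condition `β ≤ 1/9` ensures that it is nonnegative.
  nlinarith [mul_nonneg hβ0 (by nlinarith : 0 ≤ 1 - 9 * β + 12 * β ^ 2)]

theorem primalNorm_dualHess_slack_le (hF : IsNormalBarrier K F ν) (hK : IsRegular K)
    (hA : Function.Surjective A) {μ β : ℝ} (hμ : 0 < μ) (hμ1 : μ ≤ 1) (hβ0 : 0 ≤ β)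
    (hβ : β ≤ 1 / 9) {z₁ z : E × StrongDual ℝ E × H} (hz₁ : IsCentral K F A b c 1 z₁)
    (hz : IsCentral K F A b c μ z) {y : H}
    (hs : slack A c y ∈ interior (dualCone K)) (hy : y ∈ neighborhood K F A b c μ β)
    {sStar : StrongDual ℝ E} {yStar : H} (hopt : IsDualOptimal K A b c sStar yStar) :
    primalNorm (hess F z₁.1) (dualHess (dualBarrier K F) (slack A c y) sStar) ≤
      primalNorm (hess F z₁.1) (dualHess (dualBarrier K F) z.2.1 sStar) +
        6 * ν ^ 2 / μ * β := by
  have hν := hF.nonneg hK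
  have hzs := hz.mem_interior hF hK hμ
  have hx := hF.legendrePoint_mem hK hzs
  have hρ := sqrt_hess_sub_central_le hF hK hA hμ hβ0 (by linarith) hz hs hy
  have hρ1 : β / (1 - β) < 1 := by rw [div_lt_one (by linarith)]; linarith
  have h1 := hF.primalNorm_dualHess_sub_le hK hs hzs hρ1 hρ sStar
  have h2 : √(hess (dualBarrier K F) z.2.1 sStar sStar) ≤ ν := by
    refine (hF.sqrt_hess_dualBarrier_le hK hzs hopt.1).trans ?_
    rw [hz.legendrePoint_eq hF hK hμ, map_smul, smul_eq_mul, inv_mul_le_iff₀ hμ]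
    exact hz.apply_le hF hK hμ hopt
  have h3 := hF.primalNorm_hess_le hK hx hz₁.1
    (dualHess (dualBarrier K F) (slack A c y) sStar - dualHess (dualBarrier K F) z.2.1 sStar)
  -- The left side is `⟨s_1, x_μ⟩/μ`, at most `(1 + μ)ν/μ` by orthogonality of the differences of
  -- two central points; `μ ≤ 1` gives the factor two.
  have h4 : -grad F z₁.1 (legendrePoint K F z.2.1) ≤ μ⁻¹ * (2 * ν) := by
    have h5 : -grad F z₁.1 (legendrePoint K F z.2.1) = μ⁻¹ * z₁.2.1 z.1 := by
      rw [hz.legendrePoint_eq hF hK hμ, hz₁.2.2.2, one_smul, map_smul, neg_apply, smul_eq_mul,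
        mul_neg]
    rw [h5]
    refine mul_le_mul_of_nonneg_left ?_ (inv_nonneg.2 hμ.le)
    have h6 := hz₁.apply_le_of_isCentral hF hK hμ hz
    nlinarith
  have h7 : primalNorm (hess F (legendrePoint K F z.2.1))
      (dualHess (dualBarrier K F) (slack A c y) sStar - dualHess (dualBarrier K F) z.2.1 sStar) ≤
      3 * β * ν :=
    h1.trans (mul_le_mul (inv_sq_sub_one_le hβ0 hβ) h2 (Real.sqrt_nonneg _) (by positivity))
  have h8 := h3.trans (mul_le_mul h4 h7 (Real.sqrt_nonneg _) (by positivity))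
  have h9 := primalNorm_add_le (hF.hess_symm hz₁.1) (hF.hess_nonneg hz₁.1)
    (dualHess (dualBarrier K F) z.2.1 sStar)
    (dualHess (dualBarrier K F) (slack A c y) sStar - dualHess (dualBarrier K F) z.2.1 sStar)
  rw [add_sub_cancel] at h9
  have h10 : μ⁻¹ * (2 * ν) * (3 * β * ν) = 6 * ν ^ 2 / μ * β := by ring
  linarith

end Problem
end ConicIPM

theorem mainTheorem12
    {E : Type*} [NormedAddCommGroup E] [NormedSpace ℝ E] [FiniteDimensional ℝ E]
    {H : Type*} [NormedAddCommGroup H] [NormedSpace ℝ H] [FiniteDimensional ℝ H]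
    (K : ProperCone ℝ E) (hK : ConicIPM.IsRegular K)
    (F : E → ℝ) (ν : ℝ) (hF : ConicIPM.IsNormalBarrier K F ν)
    (A : E →L[ℝ] StrongDual ℝ H) (hA : Function.Surjective A)
    (b : StrongDual ℝ H) (c : StrongDual ℝ E)
    (hfeas : ConicIPM.StrictlyFeasible K A b c)
    (sStar : StrongDual ℝ E) (yStar : H)
    (hopt : ConicIPM.IsDualOptimal K A b c sStar yStar)
    (σd : ℝ)
    (hσ : ∀ μ ∈ Set.Ioc (0 : ℝ) 1,
      ConicIPM.primalNorm (ConicIPM.metricB K F A b c)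
        (ConicIPM.dualHess (ConicIPM.dualBarrier K F) (ConicIPM.centralS K F A b c μ) sStar) ≤ σd)
    (μ : ℝ) (hμ : μ ∈ Set.Ioc (0 : ℝ) 1) (β : ℝ) (hβ : β ∈ Set.Icc (0 : ℝ) (1 / 9))
    (y : H) (hy : y ∈ ConicIPM.neighborhood K F A b c μ β) :
    ConicIPM.primalNorm (ConicIPM.metricB K F A b c)
        (ConicIPM.dualHess (ConicIPM.dualBarrier K F) (ConicIPM.slack A c y) sStar)
      ≤ σd + 6 * ν ^ 2 / μ * β ∧
    ConicIPM.optimalValue K A b c - b y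
      ≤ (ν + β * (β + Real.sqrt ν) / (1 - β)) * μ := by
  obtain ⟨hμ0, hμ1⟩ := hμ
  obtain ⟨hβ0, hβ1⟩ := hβ
  have hz := ConicIPM.centralPath_spec hF hA hfeas hμ0
  have hz₁ := ConicIPM.centralPath_spec hF hA hfeas one_pos
  have hs := ConicIPM.slack_mem_interior hfeas hy.1
  exact ⟨(ConicIPM.primalNorm_dualHess_slack_le hF hK hA hμ0 hμ1 hβ0 hβ1 hz₁ hz hs hy hopt).trans
      (add_le_add (hσ μ ⟨hμ0, hμ1⟩) le_rfl),
    ConicIPM.optimalValue_sub_le hF hK hA hμ0 hβ0 (by linarith) hz hs hy hopt⟩
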